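/- Let $a$ be an odd positive integer and let $K=P(-2,3,a)$ be the pretzel knot. Let $\Delta_K^0(t)\in\mathbb Z[t]$ be its reduced Alexander polynomial, that is, the Alexander polynomial of $K$ (the determinant of the matrix of Alexander coloring conditions of a diagram of $K$ with one row and one column deleted), multiplied by the unit $\pm t^n$ that makes it a polynomial in $t$ with positive constant coefficient. Let $m>1$ be an integer such that $p=\Delta_K^0(m)$ is an odd prime. A $(p,m)$-coloring of an oriented knot diagram $D$ is an assignment of elements of $\mathbb Z/p\mathbb Z$ to the arcs of $D$ such that, at each crossing, if the over-arc has color $y$ and the incoming under-arc has color $x$, then the outgoing under-arc has color $mx+(1-m)y$ if the crossing is positive and $m^{-1}x+(1-m^{-1})y$ if it is negative; it is non-trivial if it is not constant. Let $\mathrm{mincol}_{p,m}(K)$ be the minimum of the number of distinct colors used, over all diagrams of $K$ and all their non-trivial $(p,m)$-colorings. Then non-trivial $(p,m)$-colorings of diagrams of $K$ exist, and $$a+4\le \mathrm{mincol}_{p,m}(K).$$ If moreover $m=2$, then $$\mathrm{mincol}_{p,2}(K)=a+4,$$ and the standard diagram of $P(-2,3,a)$, which has $a+5$ arcs, has a non-trivial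 $(p,2)$-coloring that uses exactly $a+4$ colors (so that exactly two of its arcs share a color). -/

import Mathlib

open Polynomial

/-! Oriented knot diagrams are encoded by signed Gauss codes: one walks once along the knot and
records, at each crossing met, its label, whether one passes over or under, and its sign. A code is
a knot diagram (on the sphere) when each crossing is met once over and once under and the surface
that the code determines has genus `0`. Knots are knot diagrams up to Reidemeister moves. -/

/-- One passage of the knot through a crossing. `pos` says that the crossing is positive: the
under-strand crosses the over-strand from its right to its left. -/
structure Passage where
  label : ℕ
  isOver : Bool
  pos : Bool
deriving DecidableEq

/-- The other passage through the same crossing. -/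
def Passage.partner (x : Passage) : Passage := ⟨x.label, !x.isOver, x.pos⟩

/-- The list of passages, read cyclically. -/
abbrev GaussCode := List Passage

namespace GaussCode

/-- Every crossing that occurs is met exactly twice, once over and once under, with one sign. -/
def WellFormed (w : GaussCode) : Prop :=
  (w.map fun x => (x.label, x.isOver)).Nodup ∧ ∀ x ∈ w, x.partner ∈ w

/-- The other strand crosses the strand of the passage `y` from right to left. -/
def leftward (y : Passage) : Bool := y.isOver == y.pos

/-- The edge from a passage `x` to the next one, `w.formPerm x`, is named by `x`. A dart `(x, true)`
is this edge run through forwards, `(x, false)` is this edge run through backwards. The next dart of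
the face on the left of a dart is found by turning left at the crossing where the dart ends. -/
def faceNext (w : GaussCode) : Passage × Bool → Passage × Bool
  | (x, true) =>
      if leftward (w.formPerm x) then ((w.formPerm x).partner, true)
      else (w.formPerm⁻¹ (w.formPerm x).partner, false)
  | (x, false) =>
      if leftward x then (w.formPerm⁻¹ x.partner, false) else (x.partner, true)

/-- The faces: classes of darts under `faceNext`. -/
def Face (w : GaussCode) : Type :=
  Quot fun d e : {d : Passage × Bool // d.1 ∈ w} => faceNext w d.1 = e.1

/-- Euler's formula `V - E + F = 2`, with `V = w.length / 2` and `E = w.length`. The empty code is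
the circle without crossings. -/
def Planar (w : GaussCode) : Prop :=
  w = [] ∨ 2 * Nat.card (Face w) = w.length + 4

/-- The code of an oriented knot diagram. -/
def IsDiagram (w : GaussCode) : Prop := w.WellFormed ∧ w.Planar

/-- Two passages in this order, or, for `e = false`, in the reverse order. -/
def pair (e : Bool) (x y : Passage) : GaussCode := if e then [x, y] else [y, x]

/-- Changes of a code that describe the same diagram (another base point, other labels), and the
Reidemeister moves. In the third move a top strand meets a middle strand at `i` and a bottom
strand at `j`, and the middle and bottom strands meet at `k`. The Booleans `t`, `m`, `b` say whether
the top strand meets `i` before `j`, the middle strand `i` before `k`, the bottom strand `j` before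
`k`. Such three segments bound a triangle exactly when the signs satisfy the two equations; the move
reverses the three orders. The two constructors are the two cyclic orders of the strands. -/
inductive Move : GaussCode → GaussCode → Prop
  | rotate (u v : GaussCode) : Move (u ++ v) (v ++ u)
  | relabel (σ : Equiv.Perm ℕ) (w : GaussCode) :
      Move w (w.map fun x => ⟨σ x.label, x.isOver, x.pos⟩)
  | r1 (i : ℕ) (o s : Bool) (w : GaussCode) : Move ([⟨i, o, s⟩, ⟨i, !o, s⟩] ++ w) w
  | r2 (i j : ℕ) (e s : Bool) (u v : GaussCode) :
      Move ([⟨i, true, s⟩, ⟨j, true, !s⟩] ++ u ++ pair e ⟨i, false, s⟩ ⟨j, false, !s⟩ ++ v) (u ++ v)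
  | r3 (i j k : ℕ) (si sj sk t m b : Bool) (u v w : GaussCode)
      (h₁ : (si == sj) = (m == b)) (h₂ : (si == sk) = (t == b)) :
      Move
        (pair t ⟨i, true, si⟩ ⟨j, true, sj⟩ ++ u ++ pair m ⟨i, false, si⟩ ⟨k, true, sk⟩ ++ v ++
          pair b ⟨j, false, sj⟩ ⟨k, false, sk⟩ ++ w)
        (pair (!t) ⟨i, true, si⟩ ⟨j, true, sj⟩ ++ u ++ pair (!m) ⟨i, false, si⟩ ⟨k, true, sk⟩ ++ v ++
          pair (!b) ⟨j, false, sj⟩ ⟨k, false, sk⟩ ++ w)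
  | r3' (i j k : ℕ) (si sj sk t m b : Bool) (u v w : GaussCode)
      (h₁ : (si == sj) = (m == b)) (h₂ : (si == sk) = (t == b)) :
      Move
        (pair t ⟨i, true, si⟩ ⟨j, true, sj⟩ ++ u ++ pair b ⟨j, false, sj⟩ ⟨k, false, sk⟩ ++ v ++
          pair m ⟨i, false, si⟩ ⟨k, true, sk⟩ ++ w)
        (pair (!t) ⟨i, true, si⟩ ⟨j, true, sj⟩ ++ u ++ pair (!b) ⟨j, false, sj⟩ ⟨k, false, sk⟩ ++ v ++
          pair (!m) ⟨i, false, si⟩ ⟨k, true, sk⟩ ++ w)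

/-- `w` and `w'` are diagrams of the same oriented knot: they are joined by a sequence of moves and
inverse moves, all between knot diagrams. -/
def SameKnot (w w' : GaussCode) : Prop :=
  Relation.EqvGen (fun v v' => IsDiagram v ∧ IsDiagram v' ∧ Move v v') w w'

/-- The arcs. An arc begins right after an under-passage and ends at the next under-passage; it is
named by the under-passage after which it begins. (The circle without crossings, whose only arc
has no such name, admits only constant colorings.) -/
def arcs (w : GaussCode) : Finset Passage := w.toFinset.filter fun x => x.isOver = false

/-- The arc that arrives at the passage `x`: the last under-passage strictly before `x` in cyclic
order (which is `x` itself if there is no other one). -/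
def arcInto (w : GaussCode) (x : Passage) : Passage :=
  ((w.rotate (w.idxOf x)).reverse.find? fun y => !y.isOver).getD x

/-- Colorings of the arcs by the linear Alexander quandle `x * y = m x + (1 - m) y` on `ℤ/p`. At the
crossing of the under-passage `x`, the incoming under-arc is `arcInto w x`, the outgoing one is `x`
and the over-arc is `arcInto w x.partner`; at a positive crossing out = in * over, at a
negative one in = out * over. Only the values of `c` on `arcs w` matter. -/
def IsColoring (p : ℕ) (m : ℤ) (w : GaussCode) (c : Passage → ZMod p) : Prop :=
  ∀ x ∈ arcs w,
    if x.pos then c x = m * c (arcInto w x) + (1 - m) * c (arcInto w x.partner)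
    else c (arcInto w x) = m * c x + (1 - m) * c (arcInto w x.partner)

/-- The number of colors that occur on the arcs. -/
def numColors {p : ℕ} (w : GaussCode) (c : Passage → ZMod p) : ℕ := ((arcs w).image c).card

/-- A coloring that is not constant on the arcs. -/
def IsNontrivialColoring (p : ℕ) (m : ℤ) (w : GaussCode) (c : Passage → ZMod p) : Prop :=
  IsColoring p m w c ∧ ∃ x ∈ arcs w, ∃ y ∈ arcs w, c x ≠ c y

/-- The minimum number of colors of a nontrivial `(p, m)`-coloring, over all diagrams of the knot
of `w`. -/
noncomputable def mincol (p : ℕ) (m : ℤ) (w : GaussCode) : ℕ :=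
  sInf {n | ∃ v, IsDiagram v ∧ SameKnot v w ∧ ∃ c, IsNontrivialColoring p m v c ∧ numColors v c = n}

/-- The matrix of the coloring conditions over `ℤ[t]`: the row of the crossing with under-passage
`x`, the column of the arc `y`. -/
noncomputable def alexanderMatrix (w : GaussCode) (x y : Passage) : ℤ[X] :=
  (if y = (if x.pos then arcInto w x else x) then X else 0) +
    (if y = arcInto w x.partner then 1 - X else 0) -
    (if y = (if x.pos then x else arcInto w x) then 1 else 0)

/-- The determinant of the Alexander matrix with one row and one column deleted, namely those of
the first under-passage of the code. -/
noncomputable def alexanderMinor (w : GaussCode) : ℤ[X] :=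
  (Matrix.of fun x y : (arcs w).filter fun z => w.find? (fun u => !u.isOver) ≠ some z =>
    alexanderMatrix w x y).det

/-- The reduced Alexander polynomial of the knot with diagram `w`: among the multiples of the minor by the units `± t ^ n`, the
polynomial with positive constant coefficient. -/
noncomputable def reducedAlexander (w : GaussCode) : ℤ[X] :=
  C (alexanderMinor w).trailingCoeff.sign *
    divX^[(alexanderMinor w).natTrailingDegree] (alexanderMinor w)

/-- A strand running through `n` positive crossings labelled `b, …, b + n - 1`, alternately over
and under, beginning with an over-passage if and only if `o = true`. -/
def strand (o : Bool) (b n : ℕ) : GaussCode :=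
  (List.range n).map fun i => ⟨b + i, o ^^ decide (Odd i), true⟩

/-- The standard diagram of the pretzel knot `P(-2, q, r)`, for `q` and `r` odd: three vertical columns
of `2`, `q` and `r` half twists side by side, neighboring ends joined at the top and at the bottom
and the outer ends joined around. In the columns `q` and `r` the strand of positive slope is the
over-strand at every crossing, in the column `-2` it is the strand of negative slope. The
crossings of the column `-2` are `0` (top) and `1`. The knot runs down the column `r` from the top
right, up the column `q` from the bottom right, down the column `-2` on the right, up the column `q`
from the bottom left, down the column `r` from the top left, and up the column `-2` on the
left. With this orientation all crossings are positive. -/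
def pretzel (q r : ℕ) : GaussCode :=
  strand true (2 + q) r ++ strand false 2 q ++ [⟨0, false, true⟩, ⟨1, true, true⟩] ++
    strand true 2 q ++ strand false (2 + q) r ++ [⟨1, false, true⟩, ⟨0, true, true⟩]

end GaussCode

/-! The lower bound comes from a determinant estimate. Take a diagram with a nontrivial coloring mod
`p` in `n` colors, use the colors rather than the arcs as unknowns, and set one of them to zero.
Each crossing gives a row `(m - 1)(in - over) + (in - out)` in `n - 1` unknowns. A rational solution
would be a rational coloring of the diagram, so if only constant ones exist, some maximal minor is
nonzero (`exists_det_ne_zero`). The coloring mod `p` makes `p` divide this minor. Expanding in the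
rows, with each resulting determinant in `{0, 1, -1}`, bounds it by `((m - 1) + 1) ^ (n - 1)`
(`abs_det_le_pow`). Hence `p ≤ m ^ (n - 1)` (`prime_le_pow_numColors`).

Having only constant rational colorings is a knot invariant (`SameKnot.onlyTrivialWalks_iff`), so it
suffices to check the standard diagram. There, elimination leaves one equation whose coefficient is
the Alexander polynomial at `m`, namely `p`, which is nonzero in `ℚ` (`onlyTrivialWalks_pretzel`).
As `m ^ (a + 2) < p` (`pow_lt_pretzelPolynomial`), it follows that `n ≥ a + 4`.

Mod `p` the same coefficient vanishes and an explicit coloring `pretzelColor` of the standard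
diagram exists. For `m = 2` two of its `a + 5` arcs agree, so the bound is attained. The closed form
`pretzelPolynomial` is tied to the Alexander minor in `reducedAlexander_pretzel`, and planarity of
the code is a count of faces (`card_face_pretzel`). -/

/-! ### Determinants with rows of unit differences -/

/-- The entries are `0` or `± 1`, with at most one `1` and at most one `-1`. -/
def IsUnitDifference {ι : Type*} (v : ι → ℤ) : Prop :=
  (∀ j, v j = 0 ∨ v j = 1 ∨ v j = -1) ∧ (∀ j k, v j = 1 → v k = 1 → j = k) ∧
    ∀ j k, v j = -1 → v k = -1 → j = k

theorem IsUnitDifference.comp {ι κ : Type*} {v : ι → ℤ} (hv : IsUnitDifference v) (f : κ → ι)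
    (hf : Function.Injective f) : IsUnitDifference (v ∘ f) :=
  ⟨fun _ => hv.1 _, fun _ _ h₁ h₂ => hf (hv.2.1 _ _ h₁ h₂), fun _ _ h₁ h₂ => hf (hv.2.2 _ _ h₁ h₂)⟩

/-- Either the entries sum to zero or there is exactly one nonzero entry. -/
theorem IsUnitDifference.sum_eq_zero_or {ι : Type*} [Fintype ι] {v : ι → ℤ}
    (hv : IsUnitDifference v) :
    ∑ j, v j = 0 ∨ ∃ j, ∀ k, k ≠ j → v k = 0 := by
  classical
  by_cases h₁ : ∃ j, v j = 1
  · obtain ⟨j, hj⟩ := h₁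
    by_cases h₂ : ∃ k, v k = -1
    · obtain ⟨k, hk⟩ := h₂
      left
      have hjk : j ≠ k := by rintro rfl; omega
      rw [← Finset.add_sum_erase _ _ (Finset.mem_univ j),
        ← Finset.add_sum_erase _ _ (Finset.mem_erase.2 ⟨hjk.symm, Finset.mem_univ k⟩), hj, hk,
        Finset.sum_eq_zero]
      · simp
      · intro l hl
        simp only [Finset.mem_erase, Finset.mem_univ, and_true] at hl
        rcases hv.1 l with h | h | h
        · exact h
        · exact absurd (hv.2.1 _ _ h hj) hl.2
        · exact absurd (hv.2.2 _ _ h hk) hl.1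
    · right
      refine ⟨j, fun k hk => ?_⟩
      rcases hv.1 k with h | h | h
      · exact h
      · exact absurd (hv.2.1 _ _ h hj) hk
      · exact absurd ⟨k, h⟩ h₂
  · by_cases h₂ : ∃ k, v k = -1
    · obtain ⟨j, hj⟩ := h₂
      right
      refine ⟨j, fun k hk => ?_⟩
      rcases hv.1 k with h | h | h
      · exact h
      · exact absurd ⟨k, h⟩ h₁
      · exact absurd (hv.2.2 _ _ h hj) hk
    · left
      refine Finset.sum_eq_zero fun k _ => ?_
      rcases hv.1 k with h | h | h
      · exact h
      · exact absurd ⟨k, h⟩ h₁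
      · exact absurd ⟨k, h⟩ h₂

/-- If all rows sum to zero, the all-ones vector lies in the kernel. Otherwise some row has a single
nonzero entry, and expanding along it reduces the size. -/
theorem abs_det_le_one_of_isUnitDifference {n : ℕ} (M : Matrix (Fin n) (Fin n) ℤ)
    (hM : ∀ i, IsUnitDifference (M i)) : |M.det| ≤ 1 := by
  induction n with
  | zero => simp
  | succ n ih =>
    by_cases h : ∀ i, ∑ j, M i j = 0
    · have : M.det = 0 := by
        rw [← Matrix.exists_mulVec_eq_zero_iff]
        refine ⟨fun _ => 1, fun h => one_ne_zero (congrFun h 0), ?_⟩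
        ext i
        simpa [Matrix.mulVec, dotProduct] using h i
      simp [this]
    · push Not at h
      obtain ⟨i, hi⟩ := h
      obtain ⟨j, hj⟩ := (hM i).sum_eq_zero_or.resolve_left hi
      rw [Matrix.det_succ_row M i, Finset.sum_eq_single j]
      · have h₁ := ih (M.submatrix i.succAbove j.succAbove) fun k =>
          (hM (i.succAbove k)).comp j.succAbove Fin.succAbove_right_injective
        have h₂ : |M i j| ≤ 1 := by
          rcases (hM i).1 j with h | h | h <;> simp [h]
        rw [abs_mul, abs_mul, abs_pow, abs_neg, abs_one, one_pow, one_mul]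
        exact mul_le_one₀ h₂ (abs_nonneg _) h₁
      · intro k _ hk
        simp [hj k hk]
      · simp

/-- By multilinearity the determinant is a sum over the sets `s` of rows taken from `U`, weighted by
`t ^ s.card`. Each mixed determinant is at most `1` in absolute value, and the weights sum to `(t +
1) ^ n`. -/
theorem abs_det_le_pow {n : ℕ} {t : ℤ} (ht : 0 ≤ t) (U W : Fin n → Fin n → ℤ)
    (hU : ∀ i, IsUnitDifference (U i)) (hW : ∀ i, IsUnitDifference (W i)) :
    |(Matrix.of (t • U + W)).det| ≤ (t + 1) ^ n := by
  have key : (Matrix.of (t • U + W)).det = ∑ s : Finset (Fin n),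
      t ^ s.card * (Matrix.of (s.piecewise U W)).det := by
    have hF : ∀ V : Fin n → Fin n → ℤ, (Matrix.of V).det =
      (Matrix.detRowAlternating (n := Fin n) (R := ℤ)).toMultilinearMap V := fun V => rfl
    simp only [hF]
    rw [MultilinearMap.map_add_univ]
    refine Finset.sum_congr rfl fun s _ => ?_
    have h := MultilinearMap.map_piecewise_smul
      (Matrix.detRowAlternating (n := Fin n) (R := ℤ)).toMultilinearMap (fun _ => t)
      (s.piecewise U W) s
    have h' : s.piecewise (t • U) W =
        s.piecewise (fun i => t • s.piecewise U W i) (s.piecewise U W) := by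
      ext i j
      by_cases hi : i ∈ s <;> simp [hi]
    rw [h', h, Finset.prod_const, smul_eq_mul]
  rw [key]
  calc _ ≤ ∑ s : Finset (Fin n), |t ^ s.card * (Matrix.of (s.piecewise U W)).det| :=
        Finset.abs_sum_le_sum_abs _ _
    _ ≤ ∑ s : Finset (Fin n), t ^ s.card * 1 ^ (Fintype.card (Fin n) - s.card) := by
        refine Finset.sum_le_sum fun s _ => ?_
        rw [abs_mul, abs_of_nonneg (pow_nonneg ht _), one_pow]
        refine mul_le_mul_of_nonneg_left (abs_det_le_one_of_isUnitDifference _ fun i => ?_)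
          (pow_nonneg ht _)
        change IsUnitDifference (s.piecewise U W i)
        by_cases hi : i ∈ s
        · rw [Finset.piecewise_eq_of_mem _ _ _ hi]; exact hU i
        · rw [Finset.piecewise_eq_of_notMem _ _ _ hi]; exact hW i
    _ = (t + 1) ^ n := by
        rw [Fintype.sum_pow_mul_eq_add_pow, Fintype.card_fin]

/-- A system of integer equations with only the trivial rational solution contains a square
subsystem with nonzero determinant. -/
theorem exists_det_ne_zero {R : Type*} {n : ℕ} (r : R → Fin n → ℤ)
    (h : ∀ g : Fin n → ℚ, (∀ x, ∑ j, (r x j : ℚ) * g j = 0) → g = 0) :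
    ∃ f : Fin n → R, Matrix.det (fun i => r (f i)) ≠ 0 := by
  set S : Set (Fin n → ℚ) := Set.range fun x j => (r x j : ℚ) with hS
  have htop : Submodule.span ℚ S = ⊤ := by
    by_contra hne
    -- If the rows do not span, a nonzero functional kills them all; its values on the standard
    -- basis are a forbidden rational solution.
    obtain ⟨φ, hφ, hle⟩ := Submodule.exists_le_ker_of_lt_top _ (lt_top_iff_ne_top.2 hne)
    have hφ' : ∀ v, φ v = ∑ j, v j * φ (Pi.single j 1) := by
      intro v
      conv_lhs => rw [pi_eq_sum_univ' v]
      simp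
    have := h (fun j => φ (Pi.single j 1)) fun x => by
      rw [← hφ' fun j => (r x j : ℚ)]
      exact hle (Submodule.subset_span ⟨x, rfl⟩)
    apply hφ
    ext v
    have hj := congrFun this v
    simpa using hj
  obtain ⟨f, hf, -, hlin⟩ := Submodule.exists_fun_fin_finrank_span_eq ℚ S
  have hn : Module.finrank ℚ (Submodule.span ℚ S) = n := by rw [htop]; simp
  choose k hk using fun i => hf i
  refine ⟨fun i => k (finCongr hn.symm i), fun hdet => ?_⟩
  have hlin' : LinearIndependent ℚ (fun i : Fin n => f (finCongr hn.symm i)) :=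
    hlin.comp _ (finCongr hn.symm).injective
  have hu := (Matrix.linearIndependent_rows_iff_isUnit
    (A := Matrix.of fun i : Fin n => f (finCongr hn.symm i))).1 hlin'
  rw [Matrix.isUnit_iff_isUnit_det, isUnit_iff_ne_zero] at hu
  apply hu
  have h3 := Int.cast_det (R := ℚ) (fun i : Fin n => r (k (finCongr hn.symm i)))
  rw [hdet] at h3
  rw [Int.cast_zero] at h3
  rw [h3]
  congr 1
  ext i j
  simp [← hk, Matrix.map]

/-- A system of integer equations with only the trivial rational solution that has a nontrivial
solution modulo `p`, with rows of a particular shape, forces `p` to be small. -/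
theorem prime_le_pow_of_solution {R : Type*} {n p : ℕ} [Fact p.Prime] {t : ℤ} (ht : 0 ≤ t)
    (U W : R → Fin n → ℤ)
    (hU : ∀ x, IsUnitDifference (U x)) (hW : ∀ x, IsUnitDifference (W x))
    (h : ∀ g : Fin n → ℚ, (∀ x, ∑ j, ((t * U x j + W x j : ℤ) : ℚ) * g j = 0) → g = 0)
    (g : Fin n → ZMod p) (hg : g ≠ 0)
    (hsol : ∀ x, ∑ j, ((t * U x j + W x j : ℤ) : ZMod p) * g j = 0) :
    (p : ℤ) ≤ (t + 1) ^ n := by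
  obtain ⟨f, hf⟩ := exists_det_ne_zero (fun x j => t * U x j + W x j) h
  set M : Matrix (Fin n) (Fin n) ℤ := fun i j => t * U (f i) j + W (f i) j with hM
  -- The solution mod `p` is a kernel vector of every square subsystem, in particular of the one
  -- that is nonsingular over `ℚ`.
  have hdvd : (p : ℤ) ∣ M.det := by
    rw [← ZMod.intCast_zmod_eq_zero_iff_dvd, Int.cast_det, ← Matrix.exists_mulVec_eq_zero_iff]
    refine ⟨g, hg, ?_⟩
    ext i
    simpa [Matrix.mulVec, dotProduct, hM, Matrix.map] using hsol (f i)
  calc (p : ℤ) ≤ |M.det| := Int.le_of_dvd (abs_pos.2 hf) ((dvd_abs _ _).2 hdvd)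
    _ = |(Matrix.of (t • (fun i => U (f i)) + fun i => W (f i))).det| := by
        congr 2
    _ ≤ _ := abs_det_le_pow ht _ _ (fun i => hU _) fun i => hW _

/-! ### Walks along a code and their invariance under Reidemeister moves -/

namespace GaussCode

section Walks
variable {K : Type*} [Field K]

/-- The color after passing, with color `c`, under a strand of color `y`. -/
def passUnder (t : K) (s : Bool) (c y : K) : K :=
  if s then t * c + (1 - t) * y else t⁻¹ * c + (1 - t⁻¹) * y

/-- Idempotence, invertibility (`passUnder_not`) and self-distributivity (`passUnder_passUnder`) are
the quandle axioms behind the three Reidemeister moves. -/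
theorem passUnder_self (t : K) (s : Bool) (c : K) : passUnder t s c c = c := by
  cases s <;> simp [passUnder] <;> ring

theorem passUnder_not {t : K} (ht : t ≠ 0) (s : Bool) (c y : K) :
    passUnder t (!s) (passUnder t s c y) y = c := by
  cases s <;> simp [passUnder] <;> field_simp <;> ring

theorem passUnder_passUnder (t : K) (s s' : Bool) (c y z : K) :
    passUnder t s (passUnder t s' c y) (passUnder t s' z y) =
      passUnder t s' (passUnder t s c z) y := by
  cases s <;> cases s' <;> simp [passUnder] <;> ring

theorem passUnder_eq_right {t : K} (ht : t ≠ 0) {s : Bool} {c y : K}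
    (h : passUnder t s c y = y) : c = y := by
  rw [← passUnder_not ht s c y, h, passUnder_self]

/-- One can walk along `w` from color `c` to color `d`, the over-strand at the crossing `i` having
color `o i`. -/
def Walk (t : K) (o : ℕ → K) : GaussCode → K → K → Prop
  | [], c, d => d = c
  | x :: w, c, d =>
      if x.isOver then o x.label = c ∧ Walk t o w c d
      else Walk t o w (passUnder t x.pos c (o x.label)) d

/-- All closed walks have constant color. -/
def OnlyTrivialWalks (t : K) (w : GaussCode) : Prop :=
  ∀ o c, Walk t o w c c → ∀ x ∈ w, o x.label = c

variable {t : K} {o o' : ℕ → K} {c d : K}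

@[simp] theorem walk_nil : Walk t o [] c d ↔ d = c := Iff.rfl

theorem walk_cons {x : Passage} {w : GaussCode} : Walk t o (x :: w) c d ↔
    if x.isOver then o x.label = c ∧ Walk t o w c d
      else Walk t o w (passUnder t x.pos c (o x.label)) d := Iff.rfl

theorem walk_append {u v : GaussCode} :
    Walk t o (u ++ v) c d ↔ ∃ e, Walk t o u c e ∧ Walk t o v e d := by
  induction u generalizing c with
  | nil => simp
  | cons x u ih =>
    rw [List.cons_append, walk_cons]
    simp only [walk_cons (w := u)]
    by_cases h : x.isOver <;> simp [h, ih, and_assoc]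

theorem walk_congr {w : GaussCode} (h : ∀ x ∈ w, o x.label = o' x.label) :
    Walk t o w c d ↔ Walk t o' w c d := by
  induction w generalizing c with
  | nil => rfl
  | cons x w ih =>
    simp only [List.mem_cons, forall_eq_or_imp] at h
    simp only [walk_cons, h.1, ih h.2]

theorem walk_of_const {w : GaussCode} (h : ∀ x ∈ w, o x.label = c) :
    Walk t o w c d ↔ d = c := by
  induction w with
  | nil => rfl
  | cons x w ih =>
    simp only [List.mem_cons, forall_eq_or_imp] at h
    by_cases hx : x.isOver <;> simp [walk_cons, hx, h.1, ih h.2, passUnder_self]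

theorem walk_map_label (σ : ℕ → ℕ) {w : GaussCode} :
    Walk t o (w.map fun x => ⟨σ x.label, x.isOver, x.pos⟩) c d ↔ Walk t (o ∘ σ) w c d := by
  induction w generalizing c with
  | nil => rfl
  | cons x w ih =>
    simp only [List.map_cons, walk_cons, ih]
    rfl

theorem mem_pair {e : Bool} {x y z : Passage} : z ∈ pair e x y ↔ z = x ∨ z = y := by
  cases e <;> simp [pair, or_comm]

/-- This and the next two lemmas describe the top, middle and bottom strand of a third move
uniformly in the order of the two passages. -/
theorem walk_pair_over (e : Bool) (i j : ℕ) (s s' : Bool) :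
    Walk t o (pair e ⟨i, true, s⟩ ⟨j, true, s'⟩) c d ↔ o i = c ∧ o j = c ∧ d = c := by
  cases e <;> simp [pair, walk_cons, and_left_comm]

theorem walk_pair_under_over (e : Bool) (i k : ℕ) (s s' : Bool) :
    Walk t o (pair e ⟨i, false, s⟩ ⟨k, true, s'⟩) c d ↔
      d = passUnder t s c (o i) ∧ o k = if e then d else c := by
  cases e <;> simp [pair, walk_cons] <;> constructor <;> rintro ⟨h₁, h₂⟩ <;> simp_all

theorem walk_pair_under (e : Bool) (j k : ℕ) (s s' : Bool) :
    Walk t o (pair e ⟨j, false, s⟩ ⟨k, false, s'⟩) c d ↔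
      d = if e then passUnder t s' (passUnder t s c (o j)) (o k)
        else passUnder t s (passUnder t s' c (o k)) (o j) := by
  cases e <;> simp [pair, walk_cons]

/-- The two displayed passages use up both the over and the under slot of the label `i`. Hence the
over-color at `i` can be changed without affecting the rest of the code. -/
theorem label_ne_of_perm {l rest : GaussCode} {i : ℕ} {b s s' : Bool}
    (hl : (l.map fun x => (x.label, x.isOver)).Nodup)
    (hp : l.Perm (⟨i, b, s⟩ :: ⟨i, !b, s'⟩ :: rest)) {x : Passage} (hx : x ∈ rest) :
    x.label ≠ i := by
  have h := (hp.map fun x => (x.label, x.isOver)).nodup_iff.1 hl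
  simp only [List.map_cons, List.nodup_cons, List.mem_cons, List.mem_map, not_or, not_exists,
    not_and] at h
  rintro rfl
  by_cases hb : x.isOver = b
  · exact h.1.2 x hx (by rw [hb])
  · exact h.2.1 x hx (by rw [Bool.eq_not.2 hb])

theorem OnlyTrivialWalks.rotate {u v : GaussCode} (h : OnlyTrivialWalks t (u ++ v)) :
    OnlyTrivialWalks t (v ++ u) := by
  intro o c hw x hx
  obtain ⟨d, hv, hu⟩ := walk_append.1 hw
  have hd := h o d (walk_append.2 ⟨c, hu, hv⟩)
  -- The part `u` is walked with constant over-color `d`, so the old and the new base point have the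
  -- same color.
  have hc : c = d := (walk_of_const fun y hy => hd y (List.mem_append_left _ hy)).1 hu
  rw [hc]
  exact hd x (List.mem_append.2 (List.mem_append.1 hx).symm)

theorem onlyTrivialWalks_relabel (σ : Equiv.Perm ℕ) (w : GaussCode) :
    OnlyTrivialWalks t (w.map fun x => ⟨σ x.label, x.isOver, x.pos⟩) ↔ OnlyTrivialWalks t w := by
  constructor
  · intro h o c hw x hx
    have := h (o ∘ σ.symm) c ((walk_map_label σ).2 (by simpa [Function.comp_assoc] using hw))
      _ (List.mem_map.2 ⟨x, hx, rfl⟩)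
    simpa using this
  · intro h o c hw x hx
    obtain ⟨y, hy, rfl⟩ := List.mem_map.1 hx
    exact h (o ∘ σ) c ((walk_map_label σ).1 hw) y hy

/-- The kink forces its over-color to be `c`: directly if it is met over first, by injectivity of
passing under if it is met under first. -/
theorem walk_r1 (ht : t ≠ 0) (i : ℕ) (b s : Bool) (w : GaussCode) :
    Walk t o ([⟨i, b, s⟩, ⟨i, !b, s⟩] ++ w) c d ↔ o i = c ∧ Walk t o w c d := by
  cases b
  · simp only [Bool.not_false, List.cons_append, List.nil_append, walk_cons, Bool.false_eq_true,
      if_false, if_true]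
    constructor
    · rintro ⟨h, hw⟩
      have : o i = c := (passUnder_eq_right ht h.symm).symm
      rw [this, passUnder_self] at hw
      exact ⟨this, hw⟩
    · rintro ⟨h, hw⟩
      rw [h, passUnder_self]
      exact ⟨rfl, hw⟩
  · simp only [Bool.not_true, List.cons_append, List.nil_append, walk_cons, Bool.false_eq_true,
      if_false, if_true]
    constructor
    · rintro ⟨h, hw⟩
      rw [h, passUnder_self] at hw
      exact ⟨h, hw⟩
    · rintro ⟨h, hw⟩
      rw [h, passUnder_self]
      exact ⟨rfl, hw⟩

theorem onlyTrivialWalks_r1 (ht : t ≠ 0) (i : ℕ) (b s : Bool) (w : GaussCode)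
    (hl : (([⟨i, b, s⟩, ⟨i, !b, s⟩] ++ w : GaussCode).map fun x => (x.label, x.isOver)).Nodup) :
    OnlyTrivialWalks t ([⟨i, b, s⟩, ⟨i, !b, s⟩] ++ w) ↔ OnlyTrivialWalks t w := by
  have hi : ∀ x ∈ w, x.label ≠ i := fun x hx => label_ne_of_perm hl (List.Perm.refl _) hx
  constructor
  · intro h o c hw x hx
    -- The crossing `i` is absent from `w`, so its over-color is free and is set to the one that the
    -- kink requires.
    have := h (Function.update o i c) c ((walk_r1 ht i b s w).2 ⟨by simp,
      (walk_congr fun y hy => by simp [hi y hy]).2 hw⟩) x (List.mem_append_right _ hx)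
    simpa [hi x hx] using this
  · intro h o c hw x hx
    obtain ⟨h₁, h₂⟩ := (walk_r1 ht i b s w).1 hw
    rcases List.mem_append.1 hx with hx | hx
    · simp only [List.mem_cons, List.not_mem_nil, or_false] at hx
      rcases hx with rfl | rfl <;> exact h₁
    · exact h o c h₂ x hx

theorem walk_r2 (ht : t ≠ 0) (i j : ℕ) (e s : Bool) (u v : GaussCode) :
    Walk t o ([⟨i, true, s⟩, ⟨j, true, !s⟩] ++ u ++ pair e ⟨i, false, s⟩ ⟨j, false, !s⟩ ++ v) c d ↔
      o i = c ∧ o j = c ∧ Walk t o (u ++ v) c d := by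
  have hpair : ∀ c', o i = c → o j = c → ∀ d',
      Walk t o (pair e ⟨i, false, s⟩ ⟨j, false, !s⟩) c' d' ↔ d' = c' := by
    intro c' h₁ h₂ d'
    have := passUnder_not ht (!s) c' c
    rw [Bool.not_not] at this
    rw [walk_pair_under, h₁, h₂, passUnder_not ht, this, ite_self]
  have htop := fun c d => walk_pair_over (t := t) (o := o) (c := c) (d := d) true i j s (!s)
  simp only [pair, if_true] at htop
  simp only [walk_append, htop]
  constructor
  · rintro ⟨x, ⟨y, ⟨z, ⟨h₁, h₂, rfl⟩, hu⟩, hp⟩, hv⟩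
    rw [hpair _ h₁ h₂] at hp
    subst hp
    exact ⟨h₁, h₂, _, hu, hv⟩
  · rintro ⟨h₁, h₂, x, hu, hv⟩
    exact ⟨x, ⟨x, ⟨c, ⟨h₁, h₂, rfl⟩, hu⟩, (hpair _ h₁ h₂ _).2 rfl⟩, hv⟩

theorem onlyTrivialWalks_r2 (ht : t ≠ 0) (i j : ℕ) (e s : Bool) (u v : GaussCode)
    (hl : (([⟨i, true, s⟩, ⟨j, true, !s⟩] ++ u ++ pair e ⟨i, false, s⟩ ⟨j, false, !s⟩ ++ v :
      GaussCode).map fun x => (x.label, x.isOver)).Nodup) :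
    OnlyTrivialWalks t
      ([⟨i, true, s⟩, ⟨j, true, !s⟩] ++ u ++ pair e ⟨i, false, s⟩ ⟨j, false, !s⟩ ++ v) ↔
        OnlyTrivialWalks t (u ++ v) := by
  have hi : ∀ x ∈ u ++ v, x.label ≠ i := fun x hx =>
    label_ne_of_perm (b := true) (s := s) (s' := s)
      (rest := ⟨j, true, !s⟩ :: ⟨j, false, !s⟩ :: (u ++ v))
      hl (by
        rw [List.perm_iff_count]; intro a; cases e <;> simp [pair, List.count_cons] <;> omega)
      (by simp [List.mem_append.1 hx])
  have hj : ∀ x ∈ u ++ v, x.label ≠ j := fun x hx =>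
    label_ne_of_perm (b := true) (s := !s) (s' := !s)
      (rest := ⟨i, true, s⟩ :: ⟨i, false, s⟩ :: (u ++ v))
      hl (by
        rw [List.perm_iff_count]; intro a; cases e <;> simp [pair, List.count_cons] <;> omega)
      (by simp [List.mem_append.1 hx])
  constructor
  · intro h o c hw x hx
    have := h (Function.update (Function.update o i c) j c) c ((walk_r2 ht i j e s u v).2
      ⟨by simp [Function.update_apply], by simp,
        (walk_congr fun y hy => by simp [hi y hy, hj y hy]).2 hw⟩) x (by
          rcases List.mem_append.1 hx with hx | hx <;> simp [hx])
    simpa [hi x hx, hj x hx] using this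
  · intro h o c hw x hx
    obtain ⟨h₁, h₂, h₃⟩ := (walk_r2 ht i j e s u v).1 hw
    have := h o c h₃
    cases e <;> simp only [pair, List.mem_append, List.mem_cons, List.not_mem_nil, or_false,
      Bool.false_eq_true, if_false, if_true] at hx this <;>
    rcases hx with ((((rfl | rfl) | hx) | rfl | rfl) | hx) <;> first | assumption | simp [this, hx]

/-- The third Reidemeister move, seen by the three strands. -/
theorem passUnder_r3 (ht : t ≠ 0) {si sj sk m b : Bool} (h₁ : (si == sj) = (m == b))
    (y c z : K) :
    (if b then passUnder t sk (passUnder t sj c y) (if m then passUnder t si z y else z)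
      else passUnder t sj (passUnder t sk c (if m then passUnder t si z y else z)) y) =
    (if !b then passUnder t sk (passUnder t sj c y) (if !m then passUnder t si z y else z)
      else passUnder t sj (passUnder t sk c (if !m then passUnder t si z y else z)) y) := by
  cases b <;> cases m <;> simp only [Bool.not_true, Bool.not_false, Bool.false_eq_true, if_true,
    if_false] at h₁ ⊢
  · obtain rfl : si = sj := by simpa using h₁
    exact (passUnder_passUnder ..).symm
  · obtain rfl : sj = !si := by cases si <;> cases sj <;> simp_all
    rw [← passUnder_passUnder, passUnder_not ht]
  · obtain rfl : sj = !si := by cases si <;> cases sj <;> simp_all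
    have := passUnder_passUnder t sk (!si) c y (passUnder t si z y)
    rwa [passUnder_not ht] at this
  · obtain rfl : si = sj := by simpa using h₁
    exact passUnder_passUnder ..

/-- A third move changes only one over-color, that of the crossing `k` of the middle and bottom
strands. A walk on one side thus becomes a walk on the other after updating `o` at `k`, with the
bottom strand leaving in the same color by `passUnder_r3`. -/
theorem OnlyTrivialWalks.r3 (ht : t ≠ 0) (i j k : ℕ) (si sj sk e m b : Bool) (u v w : GaussCode)
    (h₁ : (si == sj) = (m == b))
    (hl : ((pair e ⟨i, true, si⟩ ⟨j, true, sj⟩ ++ u ++ pair m ⟨i, false, si⟩ ⟨k, true, sk⟩ ++ v ++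
          pair b ⟨j, false, sj⟩ ⟨k, false, sk⟩ ++ w : GaussCode).map
            fun x => (x.label, x.isOver)).Nodup)
    (h : OnlyTrivialWalks t
        (pair e ⟨i, true, si⟩ ⟨j, true, sj⟩ ++ u ++ pair m ⟨i, false, si⟩ ⟨k, true, sk⟩ ++ v ++
          pair b ⟨j, false, sj⟩ ⟨k, false, sk⟩ ++ w)) :
    OnlyTrivialWalks t
        (pair (!e) ⟨i, true, si⟩ ⟨j, true, sj⟩ ++ u ++
          pair (!m) ⟨i, false, si⟩ ⟨k, true, sk⟩ ++ v ++ pair (!b) ⟨j, false, sj⟩ ⟨k, false, sk⟩ ++ w) := by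
  have hk : ∀ x ∈ ⟨i, true, si⟩ :: ⟨j, true, sj⟩ :: (u ++ v ++ w), x.label ≠ k := fun x hx =>
    label_ne_of_perm (b := true) (s := sk) (s' := sk)
      (rest := ⟨i, true, si⟩ :: ⟨j, true, sj⟩ :: (u ++ v ++ w) ++ [⟨i, false, si⟩, ⟨j, false, sj⟩])
      hl (by
        rw [List.perm_iff_count]; intro a
        cases e <;> cases m <;> cases b <;> simp [pair, List.count_cons] <;> omega)
      (List.mem_append_left _ hx)
  have hik : i ≠ k := hk ⟨i, true, si⟩ (by simp)
  have hjk : j ≠ k := hk ⟨j, true, sj⟩ (by simp)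
  intro o c hw x hx
  simp only [walk_append, walk_pair_over, walk_pair_under_over, walk_pair_under] at hw
  obtain ⟨c₅, ⟨c₄, ⟨c₃, ⟨c₂, ⟨c₁, ⟨hi, hj, rfl⟩, hu⟩, rfl, hm⟩, hv⟩, hb⟩, hw⟩ := hw
  -- The color of the middle strand at `k` in the code that `h` speaks of.
  set X := if m then passUnder t si c₂ (o i) else c₂ with hX
  have hcongr : ∀ l : GaussCode, l ⊆ u ++ v ++ w → ∀ {c d},
      Walk t o l c d → Walk t (Function.update o k X) l c d := fun l hl' _ _ hwalk =>
    (walk_congr fun y hy => by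
      rw [Function.update_of_ne (hk y (by have := hl' hy; simp_all))]).1 hwalk
  have hall := h (Function.update o k X) c₁ (by
    simp only [walk_append, walk_pair_over, walk_pair_under_over, walk_pair_under]
    refine ⟨c₅, ⟨c₄, ⟨_, ⟨c₂, ⟨c₁, ⟨?_, ?_, rfl⟩, hcongr u (by simp) hu⟩, rfl, ?_⟩,
      hcongr v (by simp) ?_⟩, ?_⟩, hcongr w (by simp) hw⟩
    · rw [Function.update_of_ne hik, hi]
    · rw [Function.update_of_ne hjk, hj]
    · rw [Function.update_self, Function.update_of_ne hik]
    · rw [Function.update_of_ne hik]; exact hv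
    · rw [Function.update_self, Function.update_of_ne hjk, hb, hX, hm, hi, hj]
      exact (passUnder_r3 ht h₁ _ _ _).symm)
  have hkc : X = c₁ := by
    have := hall ⟨k, true, sk⟩ (by cases m <;> simp [pair])
    simpa using this
  -- `X` and `o k` are the colors of the middle strand on the two sides of its passage under the
  -- color `c₁`; if one equals `c₁`, so does the other.
  have hkc' : o k = c₁ := by
    rw [hm]
    cases m
    · simp only [Bool.false_eq_true, if_false] at hX
      simp [← hX, hkc, hi, passUnder_self]
    · simp only [if_true] at hX
      rw [hi, hkc] at hX
      simpa using passUnder_eq_right ht hX.symm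
  by_cases hxk : x.label = k
  · rw [hxk, hkc']
  · have := hall x (by
      simp only [List.mem_append, mem_pair] at hx ⊢
      exact hx)
    rwa [Function.update_of_ne hxk] at this

theorem OnlyTrivialWalks.r3' (ht : t ≠ 0) (i j k : ℕ) (si sj sk e m b : Bool) (u v w : GaussCode)
    (h₁ : (si == sj) = (m == b))
    (hl : ((pair e ⟨i, true, si⟩ ⟨j, true, sj⟩ ++ u ++ pair b ⟨j, false, sj⟩ ⟨k, false, sk⟩ ++ v ++
          pair m ⟨i, false, si⟩ ⟨k, true, sk⟩ ++ w : GaussCode).map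
            fun x => (x.label, x.isOver)).Nodup)
    (h : OnlyTrivialWalks t
        (pair e ⟨i, true, si⟩ ⟨j, true, sj⟩ ++ u ++ pair b ⟨j, false, sj⟩ ⟨k, false, sk⟩ ++ v ++
          pair m ⟨i, false, si⟩ ⟨k, true, sk⟩ ++ w)) :
    OnlyTrivialWalks t
        (pair (!e) ⟨i, true, si⟩ ⟨j, true, sj⟩ ++ u ++
          pair (!b) ⟨j, false, sj⟩ ⟨k, false, sk⟩ ++ v ++ pair (!m) ⟨i, false, si⟩ ⟨k, true, sk⟩ ++ w) := by
  have hk : ∀ x ∈ ⟨i, true, si⟩ :: ⟨j, true, sj⟩ :: (u ++ v ++ w), x.label ≠ k := fun x hx =>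
    label_ne_of_perm (b := true) (s := sk) (s' := sk)
      (rest := ⟨i, true, si⟩ :: ⟨j, true, sj⟩ :: (u ++ v ++ w) ++ [⟨i, false, si⟩, ⟨j, false, sj⟩])
      hl (by
        rw [List.perm_iff_count]; intro a
        cases e <;> cases m <;> cases b <;> simp [pair, List.count_cons] <;> omega)
      (List.mem_append_left _ hx)
  have hik : i ≠ k := hk ⟨i, true, si⟩ (by simp)
  have hjk : j ≠ k := hk ⟨j, true, sj⟩ (by simp)
  intro o c hw x hx
  simp only [walk_append, walk_pair_over, walk_pair_under_over, walk_pair_under] at hw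
  obtain ⟨c₅, ⟨c₄, ⟨c₃, ⟨c₂, ⟨c₁, ⟨hi, hj, rfl⟩, hu⟩, hb⟩, hv⟩, rfl, hm⟩, hw⟩ := hw
  set X := if m then passUnder t si c₄ (o i) else c₄ with hX
  have hcongr : ∀ l : GaussCode, l ⊆ u ++ v ++ w → ∀ {c d},
      Walk t o l c d → Walk t (Function.update o k X) l c d := fun l hl' _ _ hwalk =>
    (walk_congr fun y hy => by
      rw [Function.update_of_ne (hk y (by have := hl' hy; simp_all))]).1 hwalk
  have hall := h (Function.update o k X) c₁ (by
    simp only [walk_append, walk_pair_over, walk_pair_under_over, walk_pair_under]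
    refine ⟨_, ⟨c₄, ⟨c₃, ⟨c₂, ⟨c₁, ⟨?_, ?_, rfl⟩, hcongr u (by simp) hu⟩, ?_⟩,
      hcongr v (by simp) hv⟩, rfl, ?_⟩, hcongr w (by simp) ?_⟩
    · rw [Function.update_of_ne hik, hi]
    · rw [Function.update_of_ne hjk, hj]
    · rw [Function.update_self, Function.update_of_ne hjk, hb, hX, hm, hi, hj]
      exact (passUnder_r3 ht h₁ _ _ _).symm
    · rw [Function.update_self, Function.update_of_ne hik]
    · rw [Function.update_of_ne hik]; exact hw)
  have hkc : X = c₁ := by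
    have := hall ⟨k, true, sk⟩ (by cases m <;> simp [pair])
    simpa using this
  have hkc' : o k = c₁ := by
    rw [hm]
    cases m
    · simp only [Bool.false_eq_true, if_false] at hX
      simp [← hX, hkc, hi, passUnder_self]
    · simp only [if_true] at hX
      rw [hi, hkc] at hX
      simpa using passUnder_eq_right ht hX.symm
  by_cases hxk : x.label = k
  · rw [hxk, hkc']
  · have := hall x (by
      simp only [List.mem_append, mem_pair] at hx ⊢
      exact hx)
    rwa [Function.update_of_ne hxk] at this

theorem onlyTrivialWalks_iff_of_move (ht : t ≠ 0) {v w : GaussCode}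
    (hv : v.WellFormed) (hw : w.WellFormed) (h : Move v w) :
    OnlyTrivialWalks t v ↔ OnlyTrivialWalks t w := by
  cases h with
  | rotate u v => exact ⟨.rotate, .rotate⟩
  | relabel σ w => exact (onlyTrivialWalks_relabel σ v).symm
  | r1 i b s w => exact onlyTrivialWalks_r1 ht i b s _ hv.1
  | r2 i j e s u v => exact onlyTrivialWalks_r2 ht i j e s u v hv.1
  | r3 i j k si sj sk e m b u v w h₁ h₂ =>
    refine ⟨.r3 ht i j k si sj sk e m b u v w h₁ hv.1, fun h => ?_⟩
    -- The inverse of the move is the move with all three orders reversed.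
    have := OnlyTrivialWalks.r3 ht i j k si sj sk (!e) (!m) (!b) u v w
      (by rw [h₁]; cases m <;> cases b <;> rfl) hw.1 h
    simpa using this
  | r3' i j k si sj sk e m b u v w h₁ h₂ =>
    refine ⟨.r3' ht i j k si sj sk e m b u v w h₁ hv.1, fun h => ?_⟩
    have := OnlyTrivialWalks.r3' ht i j k si sj sk (!e) (!m) (!b) u v w
      (by rw [h₁]; cases m <;> cases b <;> rfl) hw.1 h
    simpa using this

theorem SameKnot.onlyTrivialWalks_iff (ht : t ≠ 0) {v w : GaussCode}
    (h : SameKnot v w) : OnlyTrivialWalks t v ↔ OnlyTrivialWalks t w := by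
  induction h with
  | rel v w h => exact onlyTrivialWalks_iff_of_move ht h.1.1 h.2.1.1 h.2.2
  | refl => rfl
  | symm _ _ _ ih => exact ih.symm
  | trans _ _ _ _ _ ih₁ ih₂ => exact ih₁.trans ih₂

end Walks
end GaussCode

/-! ### From arc colorings to walks, and the lower bound on the number of colors -/

namespace GaussCode

theorem WellFormed.nodup {w : GaussCode} (hw : w.WellFormed) : w.Nodup := hw.1.of_map _

theorem WellFormed.eq_of_label {w : GaussCode} (hw : w.WellFormed) {x y : Passage} (hx : x ∈ w)
    (hy : y ∈ w) (hl : x.label = y.label) (ho : x.isOver = y.isOver) : x = y :=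
  List.inj_on_of_nodup_map hw.1 hx hy (by simp [hl, ho])

theorem mem_arcs {w : GaussCode} {x : Passage} : x ∈ arcs w ↔ x ∈ w ∧ x.isOver = false := by
  simp [arcs]

theorem formPerm_append_cons_cons {u v : GaussCode} {x y : Passage}
    (h : (u ++ x :: y :: v).Nodup) : (u ++ x :: y :: v).formPerm x = y := by
  have := List.formPerm_apply_lt_getElem _ h u.length (by simp)
  simpa using this

theorem formPerm_wrap (u : GaussCode) (x y : Passage) : (y :: u ++ [x]).formPerm x = y := by
  simp

theorem arcInto_append {u v : GaussCode} {x : Passage} (h : (u ++ x :: v).Nodup) :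
    arcInto (u ++ x :: v) x =
      ((x :: v ++ u).reverse.find? fun y => !y.isOver).getD x := by
  have hx : x ∉ u := by
    intro hx
    have := (List.nodup_append.1 h).2.2 x hx x (by simp)
    exact this rfl
  rw [arcInto, List.idxOf_append_of_notMem hx, List.idxOf_cons_self, add_zero,
    List.rotate_append_length_eq]

/-- Rotating the code to start at `x` exposes its successor `y`. The searches for the arcs into `x`
and into `y` then run over lists that differ only in the position of `x`. The code `[x]` has no
second passage and is kept apart. -/
theorem arcInto_formPerm_aux {w : GaussCode} (hw : w.Nodup) {x : Passage} (hx : x ∈ w) :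
    w = [x] ∨ ∃ y l, w.Perm (x :: y :: l) ∧ w.formPerm x = y ∧
      arcInto w x = ((x :: y :: l).reverse.find? fun y => !y.isOver).getD x ∧
      arcInto w y = ((y :: l ++ [x]).reverse.find? fun y => !y.isOver).getD y := by
  obtain ⟨u, v, rfl⟩ := List.append_of_mem hx
  rcases v with _ | ⟨y, v⟩
  · rcases u with _ | ⟨y, u⟩
    · exact Or.inl rfl
    · refine Or.inr ⟨y, u, by simpa using List.perm_append_comm (l₁ := y :: u) (l₂ := [x]),
        formPerm_wrap u x y, arcInto_append hw, ?_⟩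
      have := arcInto_append (u := []) (v := u ++ [x]) (x := y) hw
      simpa using this
  · refine Or.inr ⟨y, v ++ u, by simpa using List.perm_append_comm (l₁ := u) (l₂ := x :: y :: v),
      formPerm_append_cons_cons hw, arcInto_append hw, ?_⟩
    have e : u ++ x :: y :: v = (u ++ [x]) ++ y :: v := by simp
    rw [e] at hw ⊢
    rw [arcInto_append hw]
    simp

theorem arcInto_formPerm_of_under {w : GaussCode} (hw : w.Nodup) {x : Passage} (hx : x ∈ w)
    (h : x.isOver = false) : arcInto w (w.formPerm x) = x := by
  rcases arcInto_formPerm_aux hw hx with rfl | ⟨y, l, -, h₁, -, h₂⟩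
  · simp [arcInto, h]
  · rw [h₁, h₂]
    simp [h]

/-- An over-passage starts no new arc. The under-passage `z` makes both searches succeed, so that
the default value in `arcInto` plays no role. -/
theorem arcInto_formPerm_of_over {w : GaussCode} (hw : w.Nodup) {x z : Passage} (hx : x ∈ w)
    (h : x.isOver = true) (hz : z ∈ w) (hz' : z.isOver = false) :
    arcInto w (w.formPerm x) = arcInto w x := by
  rcases arcInto_formPerm_aux hw hx with rfl | ⟨y, l, hp, h₁, h₂, h₃⟩
  · simp
  · rw [h₁, h₂, h₃]
    have hz₂ : z ∈ (y :: l).reverse := by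
      have := hp.mem_iff.1 hz
      rw [List.mem_cons] at this
      rcases this with rfl | this
      · simp [h] at hz'
      · exact List.mem_reverse.2 this
    have hs : ((y :: l).reverse.find? fun y => !y.isOver).isSome :=
      List.find?_isSome.2 ⟨z, hz₂, by simp [hz']⟩
    obtain ⟨a, ha⟩ := Option.isSome_iff_exists.1 hs
    have e₁ : (y :: l ++ [x]).reverse = x :: (y :: l).reverse := by simp
    have e₂ : (x :: y :: l).reverse = (y :: l).reverse ++ [x] := by simp
    rw [e₁, e₂, List.find?_cons, List.find?_append, ha]
    simp [h]

theorem arcInto_mem_arcs {w : GaussCode} (hw : w.Nodup) {x z : Passage} (hx : x ∈ w)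
    (hz : z ∈ w) (hz' : z.isOver = false) : arcInto w x ∈ arcs w := by
  obtain ⟨u, v, rfl⟩ := List.append_of_mem hx
  rw [arcInto_append hw]
  have hs : ((x :: v ++ u).reverse.find? fun y => !y.isOver).isSome := by
    refine List.find?_isSome.2 ⟨z, ?_, by simp [hz']⟩
    simp only [List.mem_append, List.mem_cons, List.mem_reverse] at hz ⊢
    tauto
  obtain ⟨a, ha⟩ := Option.isSome_iff_exists.1 hs
  rw [ha, Option.getD_some, mem_arcs]
  have h₁ := List.mem_of_find?_eq_some ha
  have h₂ := List.find?_some ha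
  simp only [List.mem_append, List.mem_cons, List.mem_reverse] at h₁ ⊢
  exact ⟨by tauto, by simpa using h₂⟩

section
variable {K : Type*} [Field K] {t : K} {o : ℕ → K} {e : Passage → K}

/-- The colors `e x` of the edges that arrive at `x` change along `w` as the over-colors `o`
prescribe. -/
def IsEdgeColoring (t : K) (o : ℕ → K) (e : Passage → K) (w : GaussCode) : Prop :=
  ∀ x ∈ w, if x.isOver then o x.label = e x ∧ e (w.formPerm x) = e x
    else e (w.formPerm x) = passUnder t x.pos (e x) (o x.label)

theorem walk_singleton_of_isEdgeColoring {w : GaussCode} (h : IsEdgeColoring t o e w) {x : Passage}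
    (hx : x ∈ w) : Walk t o [x] (e x) (e (w.formPerm x)) := by
  have := h x hx
  by_cases hx : x.isOver <;> simp_all [walk_cons]

theorem walk_prefix_of_isEdgeColoring {z : Passage} {w' : GaussCode}
    (hw : (z :: w').Nodup) (h : IsEdgeColoring t o e (z :: w')) (u v : GaussCode) (x : Passage)
    (huv : z :: w' = u ++ x :: v) : Walk t o u (e z) (e x) := by
  induction u using List.reverseRecOn generalizing v x with
  | nil => obtain ⟨rfl, -⟩ := List.cons.inj huv; rfl
  | append_singleton u y ih =>
    have e₁ : z :: w' = u ++ y :: x :: v := by rw [huv]; simp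
    rw [walk_append]
    refine ⟨e y, ih (x :: v) y e₁, ?_⟩
    have hy := walk_singleton_of_isEdgeColoring h (x := y) (by rw [e₁]; simp)
    have hn : (z :: w').formPerm y = x := by
      rw [e₁] at hw ⊢
      exact formPerm_append_cons_cons hw
    rwa [hn] at hy

theorem walk_of_isEdgeColoring {z : Passage} {w' : GaussCode} (hw : (z :: w').Nodup)
    (h : IsEdgeColoring t o e (z :: w')) : Walk t o (z :: w') (e z) (e z) := by
  rcases List.eq_nil_or_concat (z :: w') with h' | ⟨u, y, h'⟩
  · simp at h'
  · rw [List.concat_eq_append] at h'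
    have h₁ := walk_prefix_of_isEdgeColoring hw h u [] y h'
    have h₂ := walk_singleton_of_isEdgeColoring h (x := y) (by rw [h']; simp)
    have h₃ : (z :: w').formPerm y = z := by
      rcases u with _ | ⟨y', u⟩
      · obtain ⟨rfl, rfl⟩ := List.cons.inj h'
        simp
      · obtain ⟨rfl, h₀⟩ := List.cons.inj h'
        subst h₀
        simp
    rw [h₃] at h₂
    have := walk_append.2 ⟨_, h₁, h₂⟩
    rwa [← h'] at this

theorem OnlyTrivialWalks.edge_const {w : GaussCode} (hw : w.Nodup) (ht : OnlyTrivialWalks t w)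
    (h : IsEdgeColoring t o e w) {x y : Passage} (hx : x ∈ w) (hy : y ∈ w) : e x = e y := by
  rcases w with _ | ⟨z, w⟩
  · simp at hx
  have hconst := ht o (e z) (walk_of_isEdgeColoring hw h)
  have key : ∀ x ∈ z :: w, e x = e z := by
    intro x hx
    obtain ⟨u, v, huv⟩ := List.append_of_mem hx
    refine (walk_of_const (t := t) (o := o) fun y hy => hconst y ?_).1
      (walk_prefix_of_isEdgeColoring hw h u v x huv)
    rw [huv]
    exact List.mem_append_left _ hy
  rw [key x hx, key y hy]

/-- A function on the arcs that satisfies the coloring conditions with parameter `t` is constant if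
there are only trivial closed walks. -/
theorem OnlyTrivialWalks.coloring_const {w : GaussCode} (hw : w.WellFormed) (ht₀ : t ≠ 0)
    (ht : OnlyTrivialWalks t w) (f : Passage → K)
    (hf : ∀ x ∈ arcs w,
      if x.pos then f x = t * f (arcInto w x) + (1 - t) * f (arcInto w x.partner)
      else f (arcInto w x) = t * f x + (1 - t) * f (arcInto w x.partner))
    {x y : Passage} (hx : x ∈ arcs w) (hy : y ∈ arcs w) : f x = f y := by
  classical
  -- The over-color is read off the over-passage labelled `l`. Its sign is not determined by `l`
  -- alone and has to be chosen; well-formedness makes the choice unique.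
  let o : ℕ → K := fun l => if h : ∃ s, (⟨l, true, s⟩ : Passage) ∈ w then
    f (arcInto w ⟨l, true, h.choose⟩) else 0
  have ho : ∀ z ∈ w, z.isOver = true → o z.label = f (arcInto w z) := by
    rintro ⟨l, b, s⟩ hz hb
    have hb : b = true := hb
    subst hb
    have hex : ∃ s, (⟨l, true, s⟩ : Passage) ∈ w := ⟨s, hz⟩
    have : (⟨l, true, hex.choose⟩ : Passage) = ⟨l, true, s⟩ :=
      hw.eq_of_label hex.choose_spec hz rfl rfl
    simp only [o, dif_pos hex, this]
  have hedge : IsEdgeColoring t o (fun z => f (arcInto w z)) w := by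
    intro z hz
    rcases hzo : z.isOver
    · have hz₁ := hf z (mem_arcs.2 ⟨hz, hzo⟩)
      have h₁ := ho z.partner (hw.2 z hz) (by simp [Passage.partner, hzo])
      simp only [Bool.false_eq_true, if_false, arcInto_formPerm_of_under hw.nodup hz hzo]
      rw [show o z.label = _ from h₁]
      rcases hzp : z.pos
      · simp only [hzp, Bool.false_eq_true, if_false] at hz₁
        rw [hz₁]
        simp only [passUnder, Bool.false_eq_true, if_false]
        field_simp
        ring
      · simp only [hzp, if_true] at hz₁
        rw [hz₁]
        simp only [passUnder, if_true]
    · simp only [if_true]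
      exact ⟨ho z hz hzo, congrArg f (arcInto_formPerm_of_over hw.nodup hz hzo
        (mem_arcs.1 hx).1 (mem_arcs.1 hx).2)⟩
  have hmem : ∀ z ∈ w, w.formPerm z ∈ w := fun z hz => List.formPerm_apply_mem_of_mem hz
  have hxx := mem_arcs.1 hx
  have hyy := mem_arcs.1 hy
  have := ht.edge_const hw.nodup hedge (hmem x hxx.1) (hmem y hyy.1)
  simpa [arcInto_formPerm_of_under hw.nodup hxx.1 hxx.2,
    arcInto_formPerm_of_under hw.nodup hyy.1 hyy.2] using this

end

/-- The values `a` and `b` may lie outside the range of `f`: this is the case of the color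
normalized to zero, which has no column. -/
theorem isUnitDifference_sub_indicator {ι α : Type*} [DecidableEq α] (f : ι → α)
    (hf : Function.Injective f) (a b : α) :
    IsUnitDifference fun j => (if f j = a then 1 else 0) - (if f j = b then 1 else 0 : ℤ) := by
  refine ⟨fun j => ?_, fun j k hj hk => hf ?_, fun j k hj hk => hf ?_⟩
  · dsimp only; split_ifs <;> simp
  · dsimp only at hj hk
    split_ifs at hj hk <;> simp_all
  · dsimp only at hj hk
    split_ifs at hj hk <;> simp_all

/-- If a knot diagram has only constant rational colorings, a nontrivial coloring modulo `p` needs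
many colors. -/
theorem prime_le_pow_numColors {p : ℕ} [Fact p.Prime] {m : ℤ} (hm : 1 < m) {v : GaussCode}
    (hv : v.WellFormed) (ht : OnlyTrivialWalks (m : ℚ) v) {c : Passage → ZMod p}
    (hc : IsNontrivialColoring p m v c) : (p : ℤ) ≤ m ^ (numColors v c - 1) := by
  classical
  obtain ⟨hcol, x₀, hx₀, y₀, hy₀, hne⟩ := hc
  -- The unknowns are the colors other than `c x₀`, which is set to zero; this accounts for the
  -- exponent `numColors v c - 1`.
  set I := ((arcs v).image c).erase (c x₀) with hI
  have hx₀I : c x₀ ∈ (arcs v).image c := Finset.mem_image_of_mem c hx₀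
  have hcard : I.card = numColors v c - 1 := Finset.card_erase_of_mem hx₀I
  rw [← hcard]
  let q : Fin I.card → ZMod p := fun j => (I.equivFin.symm j : ZMod p)
  have hq : Function.Injective q := Subtype.val_injective.comp I.equivFin.symm.injective
  have hqI : ∀ j, q j ∈ I := fun j => (I.equivFin.symm j).2
  have hqs : ∀ a ∈ I, ∃ j, q j = a := fun a ha => ⟨I.equivFin ⟨a, ha⟩, by simp [q]⟩
  let E : ZMod p → Fin I.card → ℤ := fun a j => if q j = a then 1 else 0
  -- At a negative crossing the incoming and the outgoing under-arc exchange roles, so all crossings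
  -- give `tgt = m * src + (1 - m) * over`.
  let src : Passage → Passage := fun x => if x.pos then arcInto v x else x
  let tgt : Passage → Passage := fun x => if x.pos then x else arcInto v x
  -- The row `m * src + (1 - m) * over - tgt` is split as `(m - 1) * (src - over) + (src - tgt)`, so
  -- that the bound `(t + 1) ^ n` is applied with `t + 1 = m`.
  let U : arcs v → Fin I.card → ℤ := fun x j =>
    E (c (src x)) j - E (c (arcInto v x.1.partner)) j
  let W : arcs v → Fin I.card → ℤ := fun x j => E (c (src x)) j - E (c (tgt x)) j
  have hsum : ∀ {R : Type} [CommRing R] (g : Fin I.card → R) (x : arcs v),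
      ∑ j, (((m - 1) * U x j + W x j : ℤ) : R) * g j =
        m * (∑ j, (E (c (src x)) j : R) * g j) +
          (1 - m) * (∑ j, (E (c (arcInto v x.1.partner)) j : R) * g j) -
            ∑ j, (E (c (tgt x)) j : R) * g j := by
    intro R _ g x
    rw [Finset.mul_sum, Finset.mul_sum, ← Finset.sum_add_distrib, ← Finset.sum_sub_distrib]
    refine Finset.sum_congr rfl fun j _ => ?_
    simp only [U, W]
    push_cast
    ring
  have hE : ∀ {R : Type} [CommRing R] (g : Fin I.card → R) (j₀ : Fin I.card),
      ∑ j, (E (q j₀) j : R) * g j = g j₀ := by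
    intro R _ g j₀
    rw [Finset.sum_eq_single j₀]
    · simp [E]
    · intro j _ hj
      simp [E, hq.ne hj]
    · simp
  have hE₀ : ∀ {R : Type} [CommRing R] (g : Fin I.card → R),
      ∑ j, (E (c x₀) j : R) * g j = 0 := by
    intro R _ g
    refine Finset.sum_eq_zero fun j _ => ?_
    have : q j ≠ c x₀ := (Finset.mem_erase.1 (hqI j)).1
    simp [E, this]
  have key := prime_le_pow_of_solution (p := p) (t := m - 1) (by omega) U W
    (fun x => isUnitDifference_sub_indicator q hq _ _)
    (fun x => isUnitDifference_sub_indicator q hq _ _) ?_ (fun j => q j - c x₀) ?_ ?_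
  · simpa using key
  · intro g hg
    -- A rational solution in the colors pulls back along `c` to a rational coloring of the arcs. It
    -- is constant, and it is zero at `x₀`.
    have hconst := fun y (hy : y ∈ arcs v) => ht.coloring_const hv
      (by exact_mod_cast (by omega : m ≠ 0))
      (fun z => ∑ j, (E (c z) j : ℚ) * g j) (fun x hx => by
        have h₁ := hg ⟨x, hx⟩
        rw [hsum] at h₁
        simp only [src, tgt] at h₁
        by_cases hp : x.pos
        · simp only [hp, if_true] at h₁ ⊢
          linear_combination -h₁
        · simp only [hp, Bool.false_eq_true, if_false] at h₁ ⊢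
          linear_combination -h₁) hy hx₀
    ext j
    obtain ⟨-, h₂⟩ := Finset.mem_erase.1 (hqI j)
    obtain ⟨y, hy, hyj⟩ := Finset.mem_image.1 h₂
    have := hconst y hy
    simp only [hyj, hE, hE₀] at this
    exact this
  · intro h
    obtain ⟨j, hj⟩ := hqs (c y₀) (Finset.mem_erase.2 ⟨hne.symm, Finset.mem_image_of_mem c hy₀⟩)
    have := congrFun h j
    simp only [hj, Pi.zero_apply, sub_eq_zero] at this
    exact hne this.symm
  · intro x
    have hG : ∀ z ∈ arcs v, ∑ j, (E (c z) j : ZMod p) * (q j - c x₀) = c z - c x₀ := by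
      intro z hz
      by_cases h : c z = c x₀
      · rw [h, hE₀, sub_self]
      · obtain ⟨j, hj⟩ := hqs (c z) (Finset.mem_erase.2 ⟨h, Finset.mem_image_of_mem c hz⟩)
        rw [← hj, hE]
    have hx := mem_arcs.1 x.2
    have hin : arcInto v x.1 ∈ arcs v := arcInto_mem_arcs hv.nodup hx.1 hx.1 hx.2
    have hov : arcInto v x.1.partner ∈ arcs v :=
      arcInto_mem_arcs hv.nodup (hv.2 _ hx.1) hx.1 hx.2
    have h₁ := hcol x x.2
    rw [hsum, hG _ hov, hG (src x) (by by_cases hp : x.1.pos <;> simp [src, hp, hin]),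
      hG (tgt x) (by by_cases hp : x.1.pos <;> simp [tgt, hp, hin])]
    simp only [src, tgt]
    by_cases hp : x.1.pos
    · simp only [hp, if_true] at h₁ ⊢
      linear_combination -h₁
    · simp only [hp, Bool.false_eq_true, if_false] at h₁ ⊢
      linear_combination -h₁

end GaussCode

/-! ### Combinatorics of the pretzel code: successors and arcs -/

namespace GaussCode

theorem length_strand (o : Bool) (b n : ℕ) : (strand o b n).length = n := by simp [strand]

theorem strand_add (o : Bool) (b i n : ℕ) :
    strand o b (i + n) = strand o b i ++ strand (o ^^ decide (Odd i)) (b + i) n := by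
  simp only [strand, List.range_add, List.map_append, List.map_map]
  congr 1
  refine List.map_congr_left fun j _ => ?_
  simp only [Function.comp_apply, Nat.odd_add, ← Nat.not_odd_iff_even]
  by_cases h : Odd i <;> by_cases h' : Odd j <;> simp [h, h', add_assoc]

theorem strand_two (o : Bool) (b : ℕ) : strand o b 2 = [⟨b, o, true⟩, ⟨b + 1, !o, true⟩] := by
  simp [strand, List.range_succ]

theorem strand_one (o : Bool) (b : ℕ) : strand o b 1 = [⟨b, o, true⟩] := by
  simp [strand]

theorem mem_strand {o : Bool} {b n : ℕ} {x : Passage} :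
    x ∈ strand o b n ↔ x.pos = true ∧ b ≤ x.label ∧ x.label < b + n ∧
      x.isOver = (o ^^ decide (Odd (x.label - b))) := by
  simp only [strand, List.mem_map, List.mem_range]
  constructor
  · rintro ⟨i, hi, rfl⟩
    simp [hi]
  · obtain ⟨l, b', s⟩ := x
    dsimp only
    rintro ⟨rfl, h₁, h₂, h₃⟩
    exact ⟨l - b, by omega, by rw [Passage.mk.injEq]; exact ⟨by omega, h₃.symm, rfl⟩⟩

theorem infix_strand (o : Bool) {b n l : ℕ} (h₁ : b ≤ l) (h₂ : l + 1 < b + n) :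
    [⟨l, o ^^ decide (Odd (l - b)), true⟩, ⟨l + 1, !(o ^^ decide (Odd (l - b))), true⟩] <:+:
      strand o b n := by
  obtain ⟨i, rfl⟩ := Nat.exists_eq_add_of_le h₁
  obtain ⟨k, rfl⟩ : ∃ k, n = i + (2 + k) := ⟨n - i - 2, by omega⟩
  rw [strand_add, strand_add, strand_two, add_tsub_cancel_left]
  exact List.infix_append' _ _ _

/-- The passage with label `l` through a positive crossing. -/
abbrev positive (l : ℕ) (o : Bool) : Passage := ⟨l, o, true⟩

theorem length_pretzel (q r : ℕ) : (pretzel q r).length = 2 * (q + r + 2) := by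
  simp [pretzel, length_strand]; ring

theorem mem_pretzel {q r : ℕ} {x : Passage} :
    x ∈ pretzel q r ↔ x.pos = true ∧ x.label < q + r + 2 := by
  obtain ⟨l, o, s⟩ := x
  simp only [pretzel, List.mem_append, mem_strand, List.mem_cons, List.not_mem_nil, or_false,
    Passage.mk.injEq]
  constructor
  · rintro ((((((h | h) | h) | h) | h)) | h)
    · exact ⟨h.1, by omega⟩
    · exact ⟨h.1, by omega⟩
    · rcases h with h | h <;> exact ⟨h.2.2, by omega⟩
    · exact ⟨h.1, by omega⟩
    · exact ⟨h.1, by omega⟩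
    · rcases h with h | h <;> exact ⟨h.2.2, by omega⟩
  · rintro ⟨rfl, h⟩
    rcases Nat.lt_or_ge l 2 with h₁ | h₁
    · interval_cases l <;> cases o <;> simp
    · rcases Nat.lt_or_ge l (2 + q) with h₂ | h₂
      · by_cases ho : o = (false ^^ decide (Odd (l - 2)))
        · simp only [h₁, h₂, ← ho, true_and, true_or, or_true]
        · have : o = (true ^^ decide (Odd (l - 2))) := by
            cases o <;> cases h : decide (Odd (l - 2)) <;> simp_all
          simp only [h₁, h₂, ← this, true_and, true_or, or_true]
      · have h₃ : l < 2 + q + r := by omega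
        by_cases ho : o = (false ^^ decide (Odd (l - (2 + q))))
        · simp only [h₃, h₂, ← ho, true_and, true_or, or_true]
        · have : o = (true ^^ decide (Odd (l - (2 + q)))) := by
            cases o <;> cases h : decide (Odd (l - (2 + q))) <;> simp_all
          simp only [h₃, h₂, ← this, true_and, true_or]

theorem pretzel_wellFormed (q r : ℕ) : (pretzel q r).WellFormed := by
  refine ⟨?_, fun x hx => ?_⟩
  · set L := (pretzel q r).map fun x => (x.label, x.isOver) with hL
    -- Distinctness by counting: all `2 * (q + r + 2)` pairs occur in a list of exactly this length.
    have h₁ : Finset.range (q + r + 2) ×ˢ (Finset.univ : Finset Bool) ⊆ L.toFinset := by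
      rintro ⟨l, o⟩ h
      simp only [Finset.mem_product, Finset.mem_range, Finset.mem_univ, and_true] at h
      rw [List.mem_toFinset, hL, List.mem_map]
      exact ⟨positive l o, mem_pretzel.2 ⟨rfl, h⟩, rfl⟩
    have h₂ := Finset.card_le_card h₁
    have h₃ : L.length = 2 * (q + r + 2) := by rw [hL, List.length_map, length_pretzel]
    have h₄ := List.toFinset_card_le L
    rw [Finset.card_product, Finset.card_range, Finset.card_univ, Fintype.card_bool] at h₂
    exact Multiset.coe_nodup.1 (Multiset.toFinset_card_eq_card_iff_nodup.1
      (show L.toFinset.card = L.length by omega))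
  · obtain ⟨h₁, h₂⟩ := mem_pretzel.1 hx
    exact mem_pretzel.2 ⟨h₁, h₂⟩

theorem formPerm_of_infix {w : GaussCode} (hw : w.Nodup) {x y : Passage} (h : [x, y] <:+: w) :
    w.formPerm x = y := by
  obtain ⟨u, v, rfl⟩ := h
  have e : u ++ [x, y] ++ v = u ++ x :: y :: v := by simp
  rw [e] at hw ⊢
  exact formPerm_append_cons_cons hw

section
variable {a : ℕ}

theorem mem_pretzel_three {l : ℕ} {o : Bool} (h : l < a + 5) : positive l o ∈ pretzel 3 a :=
  mem_pretzel.2 ⟨rfl, by simpa [positive] using (by omega : l < 3 + a + 2)⟩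

theorem pretzel_three_eq (a : ℕ) : pretzel 3 a = strand true 5 a ++
    [positive 2 false, positive 3 true, positive 4 false, positive 0 false, positive 1 true,
      positive 2 true, positive 3 false, positive 4 true] ++
    strand false 5 a ++ [positive 1 false, positive 0 true] := by
  simp [pretzel, strand, List.range_succ, Nat.odd_iff]

/-- For odd `a` a strand leaves the long column as it entered, over or under. Peeling off its end
crossings exposes the joints between the columns; `pretzel_three_eq_of_odd'` does this for the
joints at the end of the code. -/
theorem pretzel_three_eq_of_odd (ha : Odd a) : pretzel 3 a = strand true 5 (a - 1) ++
    [positive (a + 4) true, positive 2 false, positive 3 true, positive 4 false,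
      positive 0 false, positive 1 true, positive 2 true, positive 3 false, positive 4 true,
      positive 5 false] ++
    strand true 6 (a - 1) ++ [positive 1 false, positive 0 true] := by
  obtain ⟨k, rfl⟩ := ha
  rw [pretzel_three_eq, strand_add true 5 (2 * k) 1, strand_one, add_comm (2 * k) 1,
    strand_add false 5 1 (2 * k), strand_one]
  have : 5 + 2 * k = 2 * k + 5 := by ring
  simp [this, Nat.odd_iff]
  ring_nf

theorem pretzel_three_eq_of_odd' (ha : Odd a) : pretzel 3 a = positive 5 true ::
    (strand false 6 (a - 1) ++
    [positive 2 false, positive 3 true, positive 4 false, positive 0 false, positive 1 true,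
      positive 2 true, positive 3 false, positive 4 true] ++ strand false 5 (a - 1) ++
      [positive (a + 4) false, positive 1 false]) ++ [positive 0 true] := by
  obtain ⟨k, rfl⟩ := ha
  rw [pretzel_three_eq, strand_add false 5 (2 * k) 1, strand_one, add_comm (2 * k) 1,
    strand_add true 5 1 (2 * k), strand_one]
  have : 5 + 2 * k = 2 * k + 5 := by ring
  simp [this, Nat.odd_iff]
  ring_nf

/-- The passage after the passage `positive l o` of the pretzel knot. -/
def pretzelNext (a l : ℕ) (o : Bool) : Passage :=
  if l = 0 then (if o then positive 5 true else positive 1 true)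
  else if l = 1 then (if o then positive 2 true else positive 0 true)
  else if l = 4 then (if o then positive 5 false else positive 0 false)
  else if l = a + 4 then (if o then positive 2 false else positive 1 false)
  else positive (l + 1) (!o)

theorem formPerm_pretzel (ha : Odd a) {l : ℕ} (o : Bool) (hl : l < a + 5) :
    (pretzel 3 a).formPerm (positive l o) = pretzelNext a l o := by
  have hw := (pretzel_wellFormed 3 a).nodup
  have h1 : ∀ {x y : Passage}, [x, y] <:+: [positive (a + 4) true, positive 2 false,
      positive 3 true, positive 4 false, positive 0 false, positive 1 true, positive 2 true,
      positive 3 false, positive 4 true, positive 5 false] → (pretzel 3 a).formPerm x = y := by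
    intro x y h
    apply formPerm_of_infix hw
    rw [pretzel_three_eq_of_odd ha]
    exact h.trans ((List.infix_append _ _ _).trans (by
      rw [List.append_assoc]; exact List.infix_append_left ..))
  have h2 : ∀ {x y : Passage}, [x, y] <:+: [positive (a + 4) false, positive 1 false, positive 0 true]
      → (pretzel 3 a).formPerm x = y := by
    intro x y h
    apply formPerm_of_infix hw
    rw [pretzel_three_eq_of_odd' ha]
    refine h.trans (List.IsSuffix.isInfix ⟨positive 5 true ::
    (strand false 6 (a - 1) ++
    [positive 2 false, positive 3 true, positive 4 false, positive 0 false, positive 1 true,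
      positive 2 true, positive 3 false, positive 4 true] ++ strand false 5 (a - 1)), ?_⟩)
    simp
  have h3 : (pretzel 3 a).formPerm (positive 0 true) = positive 5 true := by
    rw [pretzel_three_eq_of_odd' ha]
    exact formPerm_wrap _ _ _
  have h4 : 5 ≤ l → l + 1 < a + 5 → ∀ o, (pretzel 3 a).formPerm (positive l o) =
      positive (l + 1) (!o) := by
    intro h₁ h₂ o
    apply formPerm_of_infix hw
    rw [pretzel_three_eq]
    -- The parity of `l - 5` decides which of the two strands of the long column contains the
    -- passage.
    by_cases h : o = (true ^^ decide (Odd (l - 5)))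
    · have := infix_strand true h₁ (n := a) (by omega)
      rw [← h] at this
      refine this.trans ?_
      simp only [List.append_assoc]
      exact (List.prefix_append _ _).isInfix
    · have h : o = (false ^^ decide (Odd (l - 5))) := by
        cases o <;> cases h : decide (Odd (l - 5)) <;> simp_all
      have := infix_strand false h₁ (n := a) (by omega)
      rw [← h] at this
      exact this.trans (List.infix_append _ _ _)
  unfold pretzelNext
  split_ifs with h h' h h' h h' h h'
  · subst h; rw [h']; exact h3
  · subst h; rw [Bool.not_eq_true] at h'; rw [h']
    exact h1 ⟨[positive (a + 4) true, positive 2 false, positive 3 true, positive 4 false], _, rfl⟩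
  · subst h; rw [h']
    exact h1 ⟨[positive (a + 4) true, positive 2 false, positive 3 true, positive 4 false,
      positive 0 false], _, rfl⟩
  · subst h; rw [Bool.not_eq_true] at h'; rw [h']; exact h2 ⟨[_], [], rfl⟩
  · subst h; rw [h']
    exact h1 ⟨[positive (a + 4) true, positive 2 false, positive 3 true, positive 4 false,
      positive 0 false, positive 1 true, positive 2 true, positive 3 false], _, rfl⟩
  · subst h; rw [Bool.not_eq_true] at h'; rw [h']
    exact h1 ⟨[positive (a + 4) true, positive 2 false, positive 3 true], _, rfl⟩
  · subst h; rw [h']; exact h1 ⟨[], _, rfl⟩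
  · subst h; rw [Bool.not_eq_true] at h'; rw [h']; exact h2 ⟨[], _, rfl⟩
  · by_cases h5 : 5 ≤ l
    · exact h4 h5 (by omega) o
    · have : l = 2 ∨ l = 3 := by omega
      rcases this with rfl | rfl <;> cases o
      · exact h1 ⟨[positive (a + 4) true], _, rfl⟩
      · exact h1 ⟨[positive (a + 4) true, positive 2 false, positive 3 true, positive 4 false,
          positive 0 false, positive 1 true], _, rfl⟩
      · exact h1 ⟨[positive (a + 4) true, positive 2 false, positive 3 true, positive 4 false,
          positive 0 false, positive 1 true, positive 2 true], _, rfl⟩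
      · exact h1 ⟨[positive (a + 4) true, positive 2 false], _, rfl⟩

theorem arcs_pretzel {x : Passage} :
    x ∈ arcs (pretzel 3 a) ↔ ∃ l < a + 5, x = positive l false := by
  rw [mem_arcs, mem_pretzel]
  obtain ⟨l, o, s⟩ := x
  constructor
  · rintro ⟨⟨rfl, h⟩, rfl⟩
    exact ⟨l, by dsimp only at h; omega, rfl⟩
  · rintro ⟨l', h, h'⟩
    simp only [Passage.mk.injEq] at h' ⊢
    exact ⟨⟨h'.2.2, by omega⟩, h'.2.1⟩

theorem card_arcs_pretzel : (arcs (pretzel 3 a)).card = a + 5 := by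
  have : arcs (pretzel 3 a) = (Finset.range (a + 5)).image fun l => positive l false := by
    ext x
    rw [arcs_pretzel]
    simp [eq_comm]
  rw [this, Finset.card_image_of_injective, Finset.card_range]
  intro l l' h
  simpa using h

theorem arcInto_pretzelNext_false (ha : Odd a) {l : ℕ} (hl : l < a + 5) :
    arcInto (pretzel 3 a) (pretzelNext a l false) = positive l false := by
  rw [← formPerm_pretzel ha _ hl]
  exact arcInto_formPerm_of_under (pretzel_wellFormed 3 a).nodup (mem_pretzel_three hl) rfl

theorem arcInto_pretzelNext_true (ha : Odd a) {l : ℕ} (hl : l < a + 5) :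
    arcInto (pretzel 3 a) (pretzelNext a l true) = arcInto (pretzel 3 a) (positive l true) := by
  rw [← formPerm_pretzel ha _ hl]
  exact arcInto_formPerm_of_over (pretzel_wellFormed 3 a).nodup (mem_pretzel_three hl) rfl
    (mem_pretzel_three (l := 0) (by omega)) rfl

/-- The label of the over-arc at the crossing `l` of the pretzel knot. -/
def overArc (l : ℕ) : ℕ :=
  if l = 0 then 1 else if l = 1 then 0 else if l = 2 then 0 else if l = 5 then 1 else l - 1

/-- The label of the incoming under-arc at the crossing `l` of the pretzel knot. -/
def underArc (a l : ℕ) : ℕ :=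
  if l = 0 then 4 else if l = 1 then a + 4 else if l = 2 then overArc (a + 4)
  else if l = 3 then 0 else if l = 6 then 1 else l - 2

/-- An over-passage is preceded by an under-passage, which names the arc, except at the crossings
`2` and `5`, which are reached from an over-passage of the column `-2`. -/
theorem arcInto_positive_true (ha : Odd a) {l : ℕ} (hl : l < a + 5) :
    arcInto (pretzel 3 a) (positive l true) = positive (overArc l) false := by
  have ha' := ha.pos
  have h0 : arcInto (pretzel 3 a) (positive 0 true) = positive 1 false := by
    simpa [pretzelNext] using arcInto_pretzelNext_false ha (l := 1) (by omega)
  have h1 : arcInto (pretzel 3 a) (positive 1 true) = positive 0 false := by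
    simpa [pretzelNext] using arcInto_pretzelNext_false ha (l := 0) (by omega)
  unfold overArc
  split_ifs with h h h h
  · subst h; exact h0
  · subst h; exact h1
  · subst h
    rw [← h1]
    simpa [pretzelNext] using arcInto_pretzelNext_true ha (l := 1) (by omega)
  · subst h
    rw [← h0]
    simpa [pretzelNext] using arcInto_pretzelNext_true ha (l := 0) (by omega)
  · obtain ⟨k, rfl⟩ : ∃ k, l = k + 1 := ⟨l - 1, by omega⟩
    have := arcInto_pretzelNext_false ha (l := k) (by omega)
    rwa [pretzelNext, if_neg (by omega), if_neg (by omega), if_neg (by omega),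
      if_neg (by omega)] at this

/-- Except at `0` and `1`, an under-passage is preceded by an over-passage, so its incoming arc is
the over-arc there. At `2` this is the over-arc of the last crossing `a + 4`, whose label has a
different form for `a = 1`. -/
theorem arcInto_positive_false (ha : Odd a) {l : ℕ} (hl : l < a + 5) :
    arcInto (pretzel 3 a) (positive l false) = positive (underArc a l) false := by
  have ha' := ha.pos
  have key : ∀ k, k + 1 = l → k ≠ 0 → k ≠ 1 → k ≠ 4 →
      arcInto (pretzel 3 a) (positive l false) = positive (overArc k) false := by
    rintro k rfl h0 h1 h4
    have := arcInto_pretzelNext_true ha (l := k) (by omega)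
    rwa [pretzelNext, if_neg h0, if_neg h1, if_neg h4, if_neg (by omega),
      arcInto_positive_true ha (by omega)] at this
  unfold underArc
  split_ifs with h h h h h
  · subst h
    simpa [pretzelNext] using arcInto_pretzelNext_false ha (l := 4) (by omega)
  · subst h
    simpa [pretzelNext, ha'.ne'] using arcInto_pretzelNext_false ha (l := a + 4) (by omega)
  · subst h
    have := arcInto_pretzelNext_true ha (l := a + 4) (by omega)
    rw [arcInto_positive_true ha (by omega)] at this
    simpa [pretzelNext, show a ≠ 0 by omega] using this
  · subst h; exact key 2 rfl (by omega) (by omega) (by omega)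
  · subst h; exact key 5 rfl (by omega) (by omega) (by omega)
  · by_cases h5 : l = 5
    · subst h5
      have := arcInto_pretzelNext_true ha (l := 4) (by omega)
      rw [arcInto_positive_true ha (by omega)] at this
      simpa [pretzelNext, overArc] using this
    · rw [key (l - 1) (by omega) (by omega) (by omega) (by omega), overArc, if_neg (by omega),
        if_neg (by omega), if_neg (by omega), if_neg (by omega)]
      congr 1
end

end GaussCode

/-! ### Planarity of the pretzel code -/

namespace GaussCode
section
variable {a : ℕ}

/-- The passage before the passage `positive l o` of the pretzel knot. -/
def pretzelPrev (a l : ℕ) (o : Bool) : Passage :=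
  if l = 0 then (if o then positive 1 false else positive 4 false)
  else if l = 1 then (if o then positive 0 false else positive (a + 4) false)
  else if l = 2 then (if o then positive 1 true else positive (a + 4) true)
  else if l = 5 then (if o then positive 0 true else positive 4 true)
  else positive (l - 1) (!o)

theorem formPerm_inv_pretzel (ha : Odd a) {l : ℕ} (o : Bool) (hl : l < a + 5) :
    (pretzel 3 a).formPerm⁻¹ (positive l o) = pretzelPrev a l o := by
  have ha' := ha.pos
  rw [Equiv.Perm.inv_eq_iff_eq]
  unfold pretzelPrev
  split_ifs with h h' h h' h h' h h' <;> (try subst h) <;> (try rw [Bool.not_eq_true] at h') <;>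
    (try subst h') <;> rw [formPerm_pretzel ha _ (by omega)] <;> unfold pretzelNext
  all_goals first | rfl | skip
  · simp [ha'.ne']
  · simp [ha'.ne']
  · rw [if_neg (by omega), if_neg (by omega), if_neg (by omega), if_neg (by omega), Bool.not_not,
      Nat.sub_add_cancel (by omega)]

/-- The dart that follows the dart `(positive l o, d)` of the pretzel knot in its face. -/
def pretzelFaceNext (a l : ℕ) : Bool → Bool → Passage × Bool
  | true, true =>
      if l = 0 then (positive 5 false, true) else if l = 1 then (positive 2 false, true)
      else if l = 4 then (positive 0 true, false)
      else if l = a + 4 then (positive 1 true, false)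
      else (positive l false, false)
  | false, true =>
      if l = 0 then (positive 1 false, true) else if l = 1 then (positive 0 false, true)
      else if l = 4 then (positive 1 false, false)
      else if l = a + 4 then (positive 0 false, false)
      else (positive (l + 1) false, true)
  | true, false =>
      if l = 0 then (positive 4 false, false) else if l = 1 then (positive (a + 4) false, false)
      else if l = 2 then (positive (a + 4) true, false) else (positive (l - 1) true, false)
  | false, false => (positive l true, true)

theorem faceNext_of_over {w : GaussCode} {x : Passage} {l : ℕ}
    (h : w.formPerm x = positive l true) : faceNext w (x, true) = (positive l false, true) := by
  simp [faceNext, h, leftward, Passage.partner]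

theorem faceNext_of_under {w : GaussCode} {x y : Passage} {l : ℕ}
    (h : w.formPerm x = positive l false) (h' : w.formPerm⁻¹ (positive l true) = y) :
    faceNext w (x, true) = (y, false) := by
  subst h'
  simp [faceNext, h, leftward, Passage.partner]

theorem faceNext_positive_true {w : GaussCode} {y : Passage} {l : ℕ}
    (h : w.formPerm⁻¹ (positive l false) = y) :
    faceNext w (positive l true, false) = (y, false) := by
  subst h
  simp [faceNext, leftward, Passage.partner]

theorem faceNext_pretzel (ha : Odd a) {l : ℕ} (o d : Bool) (hl : l < a + 5) :
    faceNext (pretzel 3 a) (positive l o, d) = pretzelFaceNext a l o d := by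
  have ha' := ha.pos
  have next := formPerm_pretzel ha o hl
  rcases d with _ | _ <;> rcases o with _ | _
  · simp [faceNext, leftward, pretzelFaceNext, Passage.partner]
  · rw [faceNext_positive_true (formPerm_inv_pretzel ha _ hl)]
    simp only [pretzelPrev, pretzelFaceNext, Bool.false_eq_true, if_false]
    split_ifs with h₀ h₁ h₂ h₃
    · rfl
    · rfl
    · rfl
    · subst h₃; rfl
    · rfl
  · simp only [pretzelNext, Bool.false_eq_true, if_false] at next
    simp only [pretzelFaceNext]
    split_ifs at next ⊢ with h₀ h₁ h₂ h₃
    · exact faceNext_of_over next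
    · exact faceNext_of_over next
    · rw [faceNext_of_under next (formPerm_inv_pretzel ha _ (by omega))]; rfl
    · rw [faceNext_of_under next (formPerm_inv_pretzel ha _ (by omega))]; rfl
    · exact faceNext_of_over next
  · simp only [pretzelNext, if_true] at next
    simp only [pretzelFaceNext]
    split_ifs at next ⊢ with h₀ h₁ h₂ h₃
    · exact faceNext_of_over next
    · exact faceNext_of_over next
    · rw [faceNext_of_under next (formPerm_inv_pretzel ha _ (by omega))]; rfl
    · rw [faceNext_of_under next (formPerm_inv_pretzel ha _ (by omega))]; rfl
    · rw [faceNext_of_under next (formPerm_inv_pretzel ha _ (by omega)), pretzelPrev,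
        if_neg (by omega), if_neg (by omega), if_neg (by omega), if_neg (by omega)]
      rfl

/-- A numbering of the faces of the pretzel knot. -/
def faceNumber (a : ℕ) : Passage × Bool → ℕ
  | (⟨l, true, _⟩, true) => if l = 0 then 1 else if l = 1 then a + 5 else l
  | (⟨l, false, _⟩, true) => if l < 2 then a + 6 else if l < 5 then a + 5 else 1
  | (⟨l, true, _⟩, false) => if l = 0 then 4 else if l = 1 then a + 4 else 0
  | (⟨l, false, _⟩, false) => if l = 0 then 1 else if l = 1 then a + 5 else l

theorem faceNumber_same (l : ℕ) (o : Bool) : faceNumber a (positive l o, o) =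
    if l = 0 then 1 else if l = 1 then a + 5 else l := by
  cases o <;> rfl

theorem faceNumber_false_true (l : ℕ) : faceNumber a (positive l false, true) =
    if l < 2 then a + 6 else if l < 5 then a + 5 else 1 := rfl

theorem faceNumber_true_false (l : ℕ) : faceNumber a (positive l true, false) =
    if l = 0 then 4 else if l = 1 then a + 4 else 0 := rfl

/-- Invariance under the face map, which lets the numbering descend to faces. -/
theorem faceNumber_pretzelFaceNext (ha : 0 < a) {l : ℕ} (o d : Bool) (hl : l < a + 5) :
    faceNumber a (pretzelFaceNext a l o d) = faceNumber a (positive l o, d) := by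
  rcases d with _ | _ <;> rcases o with _ | _ <;> simp only [pretzelFaceNext]
  · rfl
  · split_ifs with h₀ h₁ h₂ <;> simp only [faceNumber_same, faceNumber_true_false] <;>
      split_ifs <;> first | contradiction | omega
  · split_ifs with h₀ h₁ h₂ <;> simp only [faceNumber_same, faceNumber_false_true] <;>
      split_ifs <;> first | contradiction | omega
  · split_ifs with h₀ h₁ h₂ <;> simp only [faceNumber_same, faceNumber_false_true,
      faceNumber_true_false] <;>
      split_ifs <;> first | contradiction | omega

theorem faceNumber_lt {l : ℕ} (o d : Bool) (hl : l < a + 5) :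
    faceNumber a (positive l o, d) < a + 7 := by
  rcases d with _ | _ <;> rcases o with _ | _ <;>
    simp only [faceNumber_same, faceNumber_false_true, faceNumber_true_false] <;>
    split_ifs <;> omega

/-- The face to the left of a dart of the pretzel knot. -/
def pretzelFace (a l : ℕ) (o d : Bool) (hl : l < a + 5) : Face (pretzel 3 a) :=
  Quot.mk _ ⟨(positive l o, d), mem_pretzel_three hl⟩

theorem pretzelFace_eq (ha : Odd a) {l l' : ℕ} {o d o' d' : Bool} (hl : l < a + 5)
    (hl' : l' < a + 5) (h : pretzelFaceNext a l o d = (positive l' o', d')) :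
    pretzelFace a l o d hl = pretzelFace a l' o' d' hl' :=
  Quot.sound ((faceNext_pretzel ha o d hl).trans h)

/-- A dart of each face of the pretzel knot. -/
def faceDart (a k : ℕ) : ℕ × Bool × Bool :=
  if k = 0 then (2, true, false) else if k = 1 then (0, true, true)
  else if k = a + 5 then (1, true, true) else if k = a + 6 then (0, false, true)
  else (k, true, true)

/-- Injectivity of the numbering: the face map joins every dart to the chosen one with its number.
The faces that run along the long column need the inductions `down` and `up`. -/
theorem pretzelFace_faceDart (ha : Odd a) {l : ℕ} (o d : Bool) (hl : l < a + 5) :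
    ∃ h, pretzelFace a l o d hl = pretzelFace a (faceDart a (faceNumber a (positive l o, d))).1
      (faceDart a (faceNumber a (positive l o, d))).2.1
      (faceDart a (faceNumber a (positive l o, d))).2.2 h := by
  have ha' := ha.pos
  have reach : ∀ {k : ℕ} {l' : ℕ} {o' d' : Bool} (hl' : l' < a + 5),
      faceDart a k = (l', o', d') → pretzelFace a l o d hl = pretzelFace a l' o' d' hl' →
      ∃ h, pretzelFace a l o d hl = pretzelFace a (faceDart a k).1 (faceDart a k).2.1
        (faceDart a k).2.2 h := by
    intro k l' o' d' hl' hk h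
    rw [hk]
    exact ⟨hl', h⟩
  have down : ∀ n, ∀ (h : n + 2 < a + 5),
      pretzelFace a (n + 2) true false h = pretzelFace a 2 true false (by omega) := by
    intro n
    induction n with
    | zero => intro h; rfl
    | succ n ih =>
      intro h
      rw [← ih (by omega)]
      exact pretzelFace_eq ha _ _ (by simp [pretzelFaceNext])
  have up : ∀ n, ∀ (h : n + 5 < a + 5),
      pretzelFace a (n + 5) false true h = pretzelFace a 0 true true (by omega) := by
    intro n
    induction n with
    | zero => intro h; exact (pretzelFace_eq ha _ _ (by simp [pretzelFaceNext])).symm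
    | succ n ih =>
      intro h
      rw [← ih (by omega)]
      refine (pretzelFace_eq ha _ _ ?_).symm
      simp only [pretzelFaceNext]
      rw [if_neg (by omega), if_neg (by omega), if_neg (by omega), if_neg (by omega)]
  have back : pretzelFace a l false false hl = pretzelFace a l true true hl :=
    pretzelFace_eq ha _ _ rfl
  have f0 : pretzelFace a 1 false true (by omega) = pretzelFace a 0 false true (by omega) :=
    pretzelFace_eq ha _ _ (by simp [pretzelFaceNext])
  have f2 : pretzelFace a 1 true true (by omega) = pretzelFace a 2 false true (by omega) :=
    pretzelFace_eq ha _ _ (by simp [pretzelFaceNext])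
  have f3 : pretzelFace a 2 false true (by omega) = pretzelFace a 3 false true (by omega) :=
    pretzelFace_eq ha _ _ (by simp [pretzelFaceNext])
  have f4 : pretzelFace a 3 false true (by omega) = pretzelFace a 4 false true (by omega) :=
    pretzelFace_eq ha _ _ (by simp [pretzelFaceNext])
  have f5 : pretzelFace a 4 true true (by omega) = pretzelFace a 0 true false (by omega) :=
    pretzelFace_eq ha _ _ (by simp [pretzelFaceNext])
  have f6 : pretzelFace a (a + 4) true true (by omega) = pretzelFace a 1 true false (by omega) :=
    pretzelFace_eq ha _ _ (by simp [pretzelFaceNext]; omega)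
  rcases d with _ | _ <;> rcases o with _ | _ <;>
    simp only [faceNumber_same, faceNumber_false_true, faceNumber_true_false] <;> split_ifs with h h'
  · subst h; exact reach (by omega) (by simp [faceDart]) back
  · subst h'; exact reach (by omega) (by simp [faceDart]) back
  · exact reach hl (by unfold faceDart; split_ifs <;> first | omega | rfl) back
  · subst h; exact reach (by omega) (by simp [faceDart]) f5.symm
  · subst h'; exact reach (by omega) (by simp [faceDart]) f6.symm
  · obtain ⟨n, rfl⟩ : ∃ n, l = n + 2 := ⟨l - 2, by omega⟩
    exact reach (by omega) (by simp [faceDart]) (down n _)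
  · rcases (by omega : l = 0 ∨ l = 1) with rfl | rfl
    · exact reach (by omega) (by simp [faceDart]) rfl
    · exact reach (by omega) (by simp [faceDart]) f0
  · rcases (by omega : l = 2 ∨ l = 3 ∨ l = 4) with rfl | rfl | rfl
    · exact reach (by omega) (by simp [faceDart]) f2.symm
    · exact reach (by omega) (by simp [faceDart]) (f2.trans f3).symm
    · exact reach (by omega) (by simp [faceDart]) (f2.trans (f3.trans f4)).symm
  · obtain ⟨n, rfl⟩ : ∃ n, l = n + 5 := ⟨l - 5, by omega⟩
    exact reach (by omega) (by simp [faceDart]) (up n _)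
  · subst h; exact reach (by omega) (by simp [faceDart]) rfl
  · subst h'; exact reach (by omega) (by simp [faceDart]) rfl
  · exact reach hl (by unfold faceDart; split_ifs <;> first | omega | rfl) rfl

theorem faceDart_lt {k : ℕ} (hk : k < a + 7) : (faceDart a k).1 < a + 5 := by
  unfold faceDart
  split_ifs <;> dsimp only <;> omega

theorem faceNumber_faceDart (k : ℕ) :
    faceNumber a (positive (faceDart a k).1 (faceDart a k).2.1, (faceDart a k).2.2) = k := by
  unfold faceDart
  split_ifs <;>
    simp only [faceNumber_same, faceNumber_false_true, faceNumber_true_false] <;>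
      split_ifs <;> first | contradiction | omega

theorem card_face_pretzel (ha : Odd a) : Nat.card (Face (pretzel 3 a)) = a + 7 := by
  have hd : ∀ d : {d : Passage × Bool // d.1 ∈ pretzel 3 a}, ∃ l o e, ∃ _ : l < a + 5,
      d.1 = (positive l o, e) := by
    rintro ⟨⟨⟨l, o, s⟩, e⟩, h⟩
    obtain ⟨h₁, h₂⟩ := mem_pretzel.1 h
    dsimp only at h₁ h₂
    subst h₁
    exact ⟨l, o, e, by omega, rfl⟩
  let F : Face (pretzel 3 a) → Fin (a + 7) := Quot.lift
    (fun d => ⟨faceNumber a d.1, by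
      obtain ⟨l, o, e, hl, h⟩ := hd d
      rw [h]
      exact faceNumber_lt o e hl⟩) (by
    intro d d' h
    obtain ⟨l, o, e, hl, h'⟩ := hd d
    rw [h', faceNext_pretzel ha _ _ hl] at h
    rw [Fin.mk.injEq, h', ← h, faceNumber_pretzelFaceNext ha.pos _ _ hl])
  have hF : ∀ l o d hl, (F (pretzelFace a l o d hl) : ℕ) = faceNumber a (positive l o, d) :=
    fun _ _ _ _ => rfl
  have hrep : ∀ f : Face (pretzel 3 a), ∃ h, f = pretzelFace a (faceDart a (F f)).1
      (faceDart a (F f)).2.1 (faceDart a (F f)).2.2 h := by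
    intro f
    induction f using Quot.inductionOn with
    | h d =>
      obtain ⟨l, o, e, hl, h⟩ := hd d
      obtain ⟨d, hd'⟩ := d
      dsimp only at h
      subst h
      exact pretzelFace_faceDart ha o e hl
  have hbij : Function.Bijective F := by
    constructor
    · intro f f' h
      obtain ⟨h₁, e₁⟩ := hrep f
      obtain ⟨h₂, e₂⟩ := hrep f'
      rw [e₁, e₂]
      simp only [h]
    · intro k
      refine ⟨pretzelFace a _ (faceDart a k).2.1 (faceDart a k).2.2 (faceDart_lt k.2), ?_⟩
      ext
      rw [hF, faceNumber_faceDart k]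
  rw [Nat.card_eq_of_bijective F hbij, Nat.card_fin]

theorem pretzel_isDiagram (ha : Odd a) : IsDiagram (pretzel 3 a) :=
  ⟨pretzel_wellFormed 3 a, Or.inr (by rw [card_face_pretzel ha, length_pretzel]; ring)⟩

end
end GaussCode

/-! ### The pretzel polynomial and colorings of the standard diagram -/

namespace GaussCode

section Algebra
variable {R : Type*} [CommRing R]

/-- The sum `∑ j < n, (-t) ^ j`. -/
def alternatingSum (t : R) : ℕ → R
  | 0 => 0
  | n + 1 => 1 - t * alternatingSum t n

/-- The reduced Alexander polynomial of the pretzel knot `P(-2, 3, a)`, evaluated at `t`. -/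
def pretzelPolynomial (a : ℕ) (t : R) : R :=
  alternatingSum t a * (t ^ 4 - t ^ 2 + t) - (t - 1) * (t ^ 2 - t + 1)

theorem alternatingSum_succ (t : R) (n : ℕ) :
    alternatingSum t (n + 1) = 1 - t * alternatingSum t n := rfl

/-- This recursion is the coloring condition at successive crossings of a twist column, which is why
these sums describe the colors there. -/
theorem alternatingSum_add_two (t : R) (n : ℕ) : alternatingSum t (n + 2) =
    t * alternatingSum t n + (1 - t) * alternatingSum t (n + 1) := by
  simp only [alternatingSum_succ]
  ring

theorem add_one_mul_alternatingSum (t : R) (n : ℕ) :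
    (t + 1) * alternatingSum t n = 1 - (-t) ^ n := by
  induction n with
  | zero => simp [alternatingSum]
  | succ n ih =>
    rw [alternatingSum_succ, pow_succ]
    linear_combination -t * ih

theorem map_alternatingSum {S : Type*} [CommRing S] (f : R →+* S) (t : R) (n : ℕ) :
    f (alternatingSum t n) = alternatingSum (f t) n := by
  induction n with
  | zero => simp [alternatingSum]
  | succ n ih => simp [alternatingSum_succ, ih]

theorem map_pretzelPolynomial {S : Type*} [CommRing S] (f : R →+* S) (a : ℕ) (t : R) :
    f (pretzelPolynomial a t) = pretzelPolynomial a (f t) := by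
  simp [pretzelPolynomial, map_alternatingSum]

/-- The estimate that produces `a + 4`. Multiplication by `m + 1` removes the alternating sum, and
the remaining difference is a sum of two terms that are positive for `m ≥ 2`. -/
theorem pow_lt_pretzelPolynomial {a : ℕ} (ha : Odd a) {m : ℤ} (hm : 1 < m) :
    m ^ (a + 2) < pretzelPolynomial a m := by
  have h := add_one_mul_alternatingSum m a
  rw [ha.neg_pow] at h
  have hpos : 0 < m + 1 := by omega
  refine lt_of_mul_lt_mul_left ?_ hpos.le
  have e : (m + 1) * pretzelPolynomial a m =
      (m + 1) * m ^ (a + 2) + (m ^ a * (m * (m ^ 2 * (m - 2) + m * (m - 2) + 1)) +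
        (m ^ 2 * (m - 1) + 1)) := by
    rw [pretzelPolynomial]
    linear_combination (m ^ 4 - m ^ 2 + m) * h
  rw [e]
  have h₁ : 0 < m ^ a := pow_pos (by omega) _
  have h₂ : 0 < m ^ 2 * (m - 2) + m * (m - 2) + 1 := by
    have : 0 ≤ m - 2 := by omega
    positivity
  have h₃ : 0 < m ^ 2 * (m - 1) + 1 := by
    have : 0 ≤ m - 1 := by omega
    positivity
  have h₄ : 0 < m := by omega
  have := mul_pos h₁ (mul_pos h₄ h₂)
  linarith

end Algebra

section Walks
variable {K : Type*} [Field K] {t : K} {o : ℕ → K} {a : ℕ}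

theorem exists_colors_of_walk {w : GaussCode} {c d : K} (h : Walk t o w c d) :
    ∃ e : ℕ → K, e 0 = c ∧ e w.length = d ∧ ∀ i, ∀ hi : i < w.length,
      if w[i].isOver then o w[i].label = e i ∧ e (i + 1) = e i
      else e (i + 1) = passUnder t w[i].pos (e i) (o w[i].label) := by
  induction w generalizing c with
  | nil => exact ⟨fun _ => c, rfl, h.symm, fun i hi => absurd hi (by simp)⟩
  | cons x w ih =>
    have key : ∀ c', Walk t o w c' d → (if x.isOver then o x.label = c ∧ c' = c
        else c' = passUnder t x.pos c (o x.label)) → ∃ e : ℕ → K, e 0 = c ∧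
        e (x :: w).length = d ∧ ∀ i, ∀ hi : i < (x :: w).length,
          if (x :: w)[i].isOver then o (x :: w)[i].label = e i ∧ e (i + 1) = e i
          else e (i + 1) = passUnder t (x :: w)[i].pos (e i) (o (x :: w)[i].label) := by
      intro c' hc' hx
      obtain ⟨e, h₀, h₁, h₂⟩ := ih hc'
      refine ⟨fun n => Nat.casesOn n c e, rfl, h₁, fun i hi => ?_⟩
      cases i with
      | zero => simpa [h₀] using hx
      | succ i => simpa using h₂ i (by simpa using hi)
    rw [walk_cons] at h
    by_cases hx : x.isOver
    · rw [if_pos hx] at h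
      exact key c h.2 (by rw [if_pos hx]; exact ⟨h.1, rfl⟩)
    · rw [if_neg hx] at h
      exact key _ h (by rw [if_neg hx])

/-- After `i` crossings the two strands of a twist column have the colors `c₂ + (c₁ - c₂) * S` with
`S` the alternating sums at `i` and `i + 1`. They exchange these roles at each step, and the one
with `i + 1` is about to pass over. -/
theorem walk_strands {c₁ d₁ c₂ d₂ : K} {b n : ℕ} (h₁ : Walk t o (strand true b n) c₁ d₁)
    (h₂ : Walk t o (strand false b n) c₂ d₂) :
    (d₁ = if Odd n then c₂ + (c₁ - c₂) * alternatingSum t n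
      else c₂ + (c₁ - c₂) * alternatingSum t (n + 1)) ∧
    (d₂ = if Odd n then c₂ + (c₁ - c₂) * alternatingSum t (n + 1)
      else c₂ + (c₁ - c₂) * alternatingSum t n) ∧
    ∀ i < n, o (b + i) = c₂ + (c₁ - c₂) * alternatingSum t (i + 1) := by
  obtain ⟨e, rfl, hd₁, he⟩ := exists_colors_of_walk h₁
  obtain ⟨f, rfl, hd₂, hf⟩ := exists_colors_of_walk h₂
  rw [length_strand] at hd₁ hd₂
  subst hd₁ hd₂
  have he' : ∀ i < n, if Odd i then e (i + 1) = passUnder t true (e i) (o (b + i))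
      else o (b + i) = e i ∧ e (i + 1) = e i := by
    intro i hi
    have := he i (by rwa [length_strand])
    by_cases h : Odd i <;> simpa [strand, h] using this
  have hf' : ∀ i < n, if Odd i then o (b + i) = f i ∧ f (i + 1) = f i
      else f (i + 1) = passUnder t true (f i) (o (b + i)) := by
    intro i hi
    have := hf i (by rwa [length_strand])
    by_cases h : Odd i <;> simpa [strand, h] using this
  have key : ∀ i ≤ n, (e i = if Odd i then f 0 + (e 0 - f 0) * alternatingSum t i
        else f 0 + (e 0 - f 0) * alternatingSum t (i + 1)) ∧
      (f i = if Odd i then f 0 + (e 0 - f 0) * alternatingSum t (i + 1)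
        else f 0 + (e 0 - f 0) * alternatingSum t i) := by
    intro i
    induction i with
    | zero => intro; simp [alternatingSum]
    | succ i ih =>
      intro hi
      obtain ⟨h₃, h₄⟩ := ih (by omega)
      have h₅ := he' i (by omega)
      have h₆ := hf' i (by omega)
      rw [alternatingSum_add_two]
      by_cases h : Odd i
      · have h' : ¬ Odd (i + 1) := by simpa [Nat.odd_add_one] using h
        simp only [h, h', if_true, if_false, passUnder] at *
        rw [h₅, h₆.2, h₆.1, h₃, h₄]
        exact ⟨by ring, rfl⟩
      · have h' : Odd (i + 1) := by simpa [Nat.odd_add_one] using h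
        simp only [h, h', if_true, if_false, passUnder] at *
        rw [h₆, h₅.2, h₅.1, h₃, h₄]
        exact ⟨rfl, by ring⟩
  refine ⟨(key n le_rfl).1, (key n le_rfl).2, fun i hi => ?_⟩
  obtain ⟨h₃, h₄⟩ := key i hi.le
  have h₅ := he' i (by omega)
  have h₆ := hf' i (by omega)
  by_cases h : Odd i
  · simp only [h, if_true] at h₄ h₆
    rw [h₆.1, h₄]
  · simp only [h, if_false] at h₃ h₅
    rw [h₅.1, h₃]

theorem onlyTrivialWalks_pretzel (ha : Odd a) (ht : t ≠ 1) (hΔ : pretzelPolynomial a t ≠ 0) :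
    OnlyTrivialWalks t (pretzel 3 a) := by
  intro o A hw
  rw [pretzel_three_eq] at hw
  obtain ⟨c₃, hw, hw₄⟩ := walk_append.1 hw
  obtain ⟨c₂, hw, hw₃⟩ := walk_append.1 hw
  obtain ⟨c₁, hw₁, hw₂⟩ := walk_append.1 hw
  obtain ⟨h₁, h₃, ho⟩ := walk_strands hw₁ hw₃
  rw [if_pos ha] at h₁ h₃
  rw [alternatingSum_succ] at h₃
  simp [walk_cons, passUnder] at hw₂ hw₄
  obtain ⟨h3, h1, h2, h4, h5⟩ := hw₂
  obtain ⟨h0, h6⟩ := hw₄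
  set S := alternatingSum t a with hS
  have ht' : (1 : K) - t ≠ 0 := sub_ne_zero.2 ht.symm
  have e0 : o 0 = A := h0.trans h6.symm
  have e2 : o 2 = o 1 := h2.trans h1.symm
  have e4 : o 4 = c₂ := h4.trans h5.symm
  have hB : c₂ = t * o 1 + (1 - t) * o 3 := by
    linear_combination h5 - t * h1
  rw [e2] at h3
  -- Eliminating all other colors leaves a single equation. The powers of `1 - t` among the
  -- multipliers avoid a division when solving for `o 1`.
  have hBA : pretzelPolynomial a t * (c₂ - A) = 0 := by
    rw [pretzelPolynomial, ← hS]
    linear_combination (1 - t) * hB + (1 - t) ^ 2 * h3 + (1 - t) ^ 2 * t * h₁ -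
      (t ^ 2 - t + 1) * h6 - (t ^ 2 - t + 1) * t * h₃
  have hB' : c₂ = A := sub_eq_zero.1 ((mul_eq_zero.1 hBA).resolve_left hΔ)
  subst hB'
  rw [sub_self, zero_mul, add_zero] at h₁ h₃
  have e1 : o 1 = c₂ := by
    apply mul_left_cancel₀ ht'
    linear_combination -h6 - t * h₃
  have e3 : o 3 = c₂ := by
    rw [h3, h₁, e1]
    ring
  rintro ⟨l, b, s⟩ hx
  have hl := (mem_pretzel.1 hx).2
  dsimp only at hl ⊢
  rcases Nat.lt_or_ge l 5 with h | h
  · interval_cases l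
    · exact e0
    · exact e1
    · rw [e2, e1]
    · exact e3
    · exact e4
  · have := ho (l - 5) (by omega)
    rw [Nat.add_sub_cancel' h] at this
    simpa using this

end Walks

section Coloring
variable {a : ℕ}

/-- A coloring of the pretzel knot, valid if `pretzelPolynomial a t` vanishes; the argument is the
label of an arc. -/
def pretzelColor {R : Type*} [CommRing R] (a : ℕ) (t : R) (l : ℕ) : R :=
  if l = 0 then t ^ 2 * alternatingSum t a
  else if l = 1 then 0
  else if l = 2 then t * ((t - 1) * (1 - alternatingSum t a)) +
    (1 - t) * (t ^ 2 * alternatingSum t a)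
  else if l = 3 then t - 1
  else if l = 4 then t * alternatingSum t a
  else (t - 1) * (t * alternatingSum t (l - 4))

theorem pretzelColor_eq {R : Type*} [CommRing R] (ha : Odd a) {t : R}
    (hΔ : pretzelPolynomial a t = 0) {l : ℕ} (hl : l < a + 5) :
    pretzelColor a t l =
      t * pretzelColor a t (underArc a l) + (1 - t) * pretzelColor a t (overArc l) := by
  have ha' := ha.pos
  have hlast : pretzelColor a t (a + 4) = (t - 1) * (t * alternatingSum t a) := by
    simp [pretzelColor, ha'.ne', show a + 4 ≠ 1 by omega, show a + 4 ≠ 2 by omega,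
      show a + 4 ≠ 3 by omega]
  have hlast' : pretzelColor a t (overArc (a + 4)) = (t - 1) * (1 - alternatingSum t a) := by
    rcases (by obtain ⟨k, rfl⟩ := ha; omega : a = 1 ∨ 3 ≤ a) with rfl | h3
    · simp [overArc, pretzelColor, alternatingSum]
    · obtain ⟨k, rfl⟩ := Nat.exists_eq_add_of_le h3
      rw [overArc, if_neg (by omega), if_neg (by omega), if_neg (by omega), if_neg (by omega),
        pretzelColor, if_neg (by omega), if_neg (by omega), if_neg (by omega), if_neg (by omega),
        if_neg (by omega), show 3 + k + 4 - 1 - 4 = k + 2 by omega, show 3 + k = k + 2 + 1 by ring,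
        alternatingSum_succ t (k + 2)]
      ring
  rw [pretzelPolynomial] at hΔ
  -- Only the crossings `3` and `4` need the polynomial to vanish; at the others the condition is an
  -- identity in `t`.
  rcases (by omega : l = 0 ∨ l = 1 ∨ l = 2 ∨ l = 3 ∨ l = 4 ∨ l = 5 ∨ l = 6 ∨ 7 ≤ l) with
    rfl | rfl | rfl | rfl | rfl | rfl | rfl | h7
  · simp [underArc, overArc, pretzelColor]
    ring
  · simp only [underArc, if_neg one_ne_zero, if_true, hlast]
    simp [overArc, pretzelColor]
    ring
  · simp only [underArc, if_neg two_ne_zero, if_neg (show ¬ 2 = 1 by omega), if_true, hlast']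
    simp [overArc, pretzelColor]
  · simp [underArc, overArc, pretzelColor]
    linear_combination -hΔ
  · simp [underArc, overArc, pretzelColor]
    linear_combination hΔ
  · simp [underArc, overArc, pretzelColor, alternatingSum]
    ring
  · simp [underArc, overArc, pretzelColor, alternatingSum]
    ring
  · obtain ⟨k, rfl⟩ := Nat.exists_eq_add_of_le h7
    rw [underArc, if_neg (by omega), if_neg (by omega), if_neg (by omega), if_neg (by omega),
      if_neg (by omega), overArc, if_neg (by omega), if_neg (by omega), if_neg (by omega),
      if_neg (by omega)]
    simp only [pretzelColor]
    rw [if_neg (by omega), if_neg (by omega), if_neg (by omega), if_neg (by omega),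
      if_neg (by omega), if_neg (by omega), if_neg (by omega), if_neg (by omega),
      if_neg (by omega), if_neg (by omega), if_neg (by omega), if_neg (by omega),
      if_neg (by omega), if_neg (by omega), if_neg (by omega),
      show 7 + k - 4 = k + 1 + 2 by omega, show 7 + k - 2 - 4 = k + 1 by omega,
      show 7 + k - 1 - 4 = k + 2 by omega, alternatingSum_add_two]
    ring

theorem pretzelColor_isNontrivialColoring (ha : Odd a) {p : ℕ} {m : ℤ}
    (hΔ : pretzelPolynomial a (m : ZMod p) = 0) (hm : (m : ZMod p) ≠ 1) :
    IsNontrivialColoring p m (pretzel 3 a) fun x => pretzelColor a (m : ZMod p) x.label := by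
  refine ⟨fun x hx => ?_, positive 3 false, arcs_pretzel.2 ⟨3, by omega, rfl⟩, positive 1 false,
    arcs_pretzel.2 ⟨1, by omega, rfl⟩, ?_⟩
  · obtain ⟨l, hl, rfl⟩ := arcs_pretzel.1 hx
    rw [if_pos rfl, arcInto_positive_false ha hl,
      show (positive l false).partner = positive l true from rfl, arcInto_positive_true ha hl]
    exact pretzelColor_eq ha hΔ hl
  · simpa [pretzelColor, sub_eq_zero] using hm

/-- For `t = 2`, two arcs have the same color. -/
theorem numColors_pretzelColor_le (ha : Odd a) {p : ℕ} {m : ℤ} (hm : m = 2) :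
    numColors (pretzel 3 a) (fun x => pretzelColor a (m : ZMod p) x.label) ≤ a + 4 := by
  have ha' := ha.pos
  have hsub : (arcs (pretzel 3 a)).image (fun x => pretzelColor a (m : ZMod p) x.label) ⊆
      (Finset.range (a + 4)).image (pretzelColor a (m : ZMod p)) := by
    intro y hy
    obtain ⟨x, hx, rfl⟩ := Finset.mem_image.1 hy
    obtain ⟨l, hl, rfl⟩ := arcs_pretzel.1 hx
    dsimp only
    rcases Nat.lt_succ_iff_lt_or_eq.1 hl with h | rfl
    · exact Finset.mem_image_of_mem _ (Finset.mem_range.2 h)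
    -- The colors of the arcs `4` and `a + 4` differ by the factor `t - 1`, which is `1` for `t =
    -- 2`.
    · refine Finset.mem_image.2 ⟨4, Finset.mem_range.2 (by omega), ?_⟩
      subst hm
      simp only [pretzelColor]
      simp [ha'.ne', show a + 4 ≠ 2 by omega, show a + 4 ≠ 3 by omega]
      ring
  exact (Finset.card_le_card hsub).trans (Finset.card_image_le.trans (Finset.card_range _).le)

end Coloring
end GaussCode

/-! ### The Alexander minor of the pretzel knot -/

/-- A determinant computed by elimination: the columns of `V` solve all equations of the system `M`
but those of the block `κ`. -/
theorem Matrix.det_eq_det_mul_det_of_elimination {R κ ι' ι : Type*} [CommRing R] [Fintype κ]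
    [DecidableEq κ] [Fintype ι'] [DecidableEq ι'] [Fintype ι] [DecidableEq ι] (M : Matrix ι ι R)
    (e : κ ⊕ ι' ≃ ι) (V : Matrix ι κ R)
    (hV : ∀ k k', V (e (Sum.inl k)) k' = (1 : Matrix κ κ R) k k')
    (h0 : ∀ i k, (M * V) (e (Sum.inr i)) k = 0) :
    M.det = (Matrix.of fun k k' => (M * V) (e (Sum.inl k)) k').det *
      (Matrix.of fun i j => M (e (Sum.inr i)) (e (Sum.inr j))).det := by
  set N := M.submatrix e e with hN
  set X : Matrix ι' κ R := Matrix.of fun i k => V (e (Sum.inr i)) k with hX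
  have hMV : ∀ s k, (M * V) (e s) k = ∑ k', N s (Sum.inl k') * (1 : Matrix κ κ R) k' k +
      ∑ i, N s (Sum.inr i) * X i k := by
    intro s k
    rw [Matrix.mul_apply, ← e.sum_comp, Fintype.sum_sum_type]
    simp [hN, hX, hV]
  -- Multiplying by a block matrix of determinant `1` adds column combinations that clear the lower
  -- left block.
  have hmul : N * Matrix.fromBlocks 1 0 X 1 = Matrix.fromBlocks
      (Matrix.of fun k k' => (M * V) (e (Sum.inl k)) k') N.toBlocks₁₂ 0 N.toBlocks₂₂ := by
    conv_lhs => rw [← Matrix.fromBlocks_toBlocks N]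
    rw [Matrix.fromBlocks_multiply]
    congr 1
    · ext k k'
      simp only [Matrix.of_apply, hMV]
      rfl
    · simp
    · ext i k
      rw [Matrix.zero_apply, ← h0 i k, hMV]
      rfl
    · simp
  have h := congrArg Matrix.det hmul
  rw [Matrix.det_mul, Matrix.det_fromBlocks_zero₁₂, Matrix.det_fromBlocks_zero₂₁, Matrix.det_one,
    Matrix.det_one, mul_one, mul_one, hN, Matrix.det_submatrix_equiv_self] at h
  exact h

namespace GaussCode
variable {a : ℕ}

theorem alexanderMatrix_pretzel (ha : Odd a) {l : ℕ} (hl : l < a + 5) (y : Passage) :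
    alexanderMatrix (pretzel 3 a) (positive l false) y =
      (if y = positive (underArc a l) false then X else 0) +
        (if y = positive (overArc l) false then 1 - X else 0) -
          if y = positive l false then 1 else 0 := by
  rw [alexanderMatrix, if_pos rfl, if_pos rfl, arcInto_positive_false ha hl,
    show (positive l false).partner = positive l true from rfl, arcInto_positive_true ha hl]

theorem underArc_lt {l : ℕ} (hl : l < a + 5) : underArc a l < a + 5 := by
  unfold underArc overArc
  split_ifs <;> omega

theorem overArc_lt {l : ℕ} (hl : l < a + 5) : overArc l < a + 5 := by
  unfold overArc
  split_ifs <;> omega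

/-- Elimination in the Alexander minor of the pretzel knot: `z` is the deleted label, `lab` lists
the other ones. -/
theorem alexanderMinor_pretzel_of_elimination (ha : Odd a) {n z : ℕ}
    (hz : (pretzel 3 a).find? (fun u => !u.isOver) = some (positive z false))
    (lab : Fin 3 ⊕ Fin n → ℕ) (hinj : Function.Injective lab)
    (hlab : ∀ l, (∃ s, lab s = l) ↔ l < a + 5 ∧ l ≠ z) (V : ℕ → Fin 3 → ℤ[X])
    (hVz : V z = 0) (hV : ∀ k k', V (lab (Sum.inl k)) k' = (1 : Matrix (Fin 3) (Fin 3) ℤ[X]) k k')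
    (h0 : ∀ j k, V (lab (Sum.inr j)) k = X * V (underArc a (lab (Sum.inr j))) k +
      (1 - X) * V (overArc (lab (Sum.inr j))) k)
    (htri : ∀ i j, i ≤ j → lab (Sum.inr j) ≠ underArc a (lab (Sum.inr i)) ∧
      lab (Sum.inr j) ≠ overArc (lab (Sum.inr i))) :
    alexanderMinor (pretzel 3 a) = (Matrix.of fun k k' : Fin 3 =>
      X * V (underArc a (lab (Sum.inl k))) k' + (1 - X) * V (overArc (lab (Sum.inl k))) k' -
        V (lab (Sum.inl k)) k').det * (-1) ^ n := by
  let A : Finset Passage := (arcs (pretzel 3 a)).filter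
    fun y => (pretzel 3 a).find? (fun u => !u.isOver) ≠ some y
  have hmem : ∀ x, x ∈ A ↔ ∃ s, x = positive (lab s) false := by
    intro x
    rw [Finset.mem_filter, arcs_pretzel, hz]
    constructor
    · rintro ⟨⟨l, hl, rfl⟩, h⟩
      obtain ⟨s, rfl⟩ := (hlab l).2 ⟨hl, by rintro rfl; exact h rfl⟩
      exact ⟨s, rfl⟩
    · rintro ⟨s, rfl⟩
      obtain ⟨h₁, h₂⟩ := (hlab _).1 ⟨s, rfl⟩
      exact ⟨⟨_, h₁, rfl⟩, fun h => h₂ (congrArg Passage.label (Option.some.inj h)).symm⟩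
  let e : Fin 3 ⊕ Fin n ≃ A :=
    Equiv.ofBijective (fun s => ⟨positive (lab s) false, (hmem _).2 ⟨s, rfl⟩⟩)
      ⟨fun s s' h => hinj (congrArg Passage.label (Subtype.mk.inj h)), fun ⟨x, hx⟩ => by
        obtain ⟨s, rfl⟩ := (hmem x).1 hx
        exact ⟨s, rfl⟩⟩
  have he : ∀ s, (e s : Passage) = positive (lab s) false := fun s => rfl
  have hlt : ∀ s, lab s < a + 5 := fun s => ((hlab _).1 ⟨s, rfl⟩).1
  have hsum : ∀ l < a + 5, ∀ c : ℤ[X], ∀ k, ∑ s, (if positive (lab s) false = positive l false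
      then c else 0) * V (lab s) k = c * V l k := by
    intro l hl c k
    by_cases hlz : l = z
    · subst hlz
      rw [hVz, Pi.zero_apply, mul_zero]
      refine Finset.sum_eq_zero fun s _ => ?_
      have := ((hlab _).1 ⟨s, rfl⟩).2
      rw [if_neg (by simpa using this), zero_mul]
    · obtain ⟨s, rfl⟩ := (hlab l).2 ⟨hl, hlz⟩
      rw [Finset.sum_eq_single s]
      · rw [if_pos rfl]
      · intro s' _ hs'
        rw [if_neg (by simpa using hinj.ne hs'), zero_mul]
      · simp
  set M : Matrix A A ℤ[X] := Matrix.of fun x y => alexanderMatrix (pretzel 3 a) x y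
    with hM
  have hMV : ∀ s k, (M * Matrix.of fun (x : A) k => V x.1.label k) (e s) k =
      X * V (underArc a (lab s)) k + (1 - X) * V (overArc (lab s)) k - V (lab s) k := by
    intro s k
    rw [Matrix.mul_apply, ← e.sum_comp]
    simp only [hM, Matrix.of_apply, he, alexanderMatrix_pretzel ha (hlt s), sub_mul, add_mul,
      Finset.sum_add_distrib, Finset.sum_sub_distrib]
    rw [hsum _ (underArc_lt (hlt s)), hsum _ (overArc_lt (hlt s)), hsum _ (hlt s)]
    ring
  have hdet := M.det_eq_det_mul_det_of_elimination e (Matrix.of fun (x : A) k => V x.1.label k)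
    (fun k k' => hV k k') (fun i k => by rw [hMV, ← h0 i k, sub_self])
  -- In the listed order each eliminated crossing involves only earlier arcs besides its own, so
  -- this block is lower triangular with diagonal `-1`.
  have htd : (Matrix.of fun i j => M (e (Sum.inr i)) (e (Sum.inr j))).det = (-1) ^ n := by
    rw [Matrix.det_of_isLowerTriangular]
    · have : ∀ i : Fin n, M (e (Sum.inr i)) (e (Sum.inr i)) = -1 := by
        intro i
        have h := htri i i le_rfl
        simp only [hM, Matrix.of_apply, he, alexanderMatrix_pretzel ha (hlt _)]
        rw [if_neg (by simpa using h.1), if_neg (by simpa using h.2)]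
        simp
      simp [this]
    · intro i j hij
      have hij : i < j := hij
      have h := htri i j hij.le
      have h' : lab (Sum.inr j) ≠ lab (Sum.inr i) :=
        hinj.ne (fun h => hij.ne' (Sum.inr.inj h))
      simp only [hM, Matrix.of_apply, he, alexanderMatrix_pretzel ha (hlt _)]
      rw [if_neg (by simpa using h.1), if_neg (by simpa using h.2), if_neg (by simpa using h')]
      ring
  rw [htd] at hdet
  simp only [hMV] at hdet
  exact hdet

/-- Treated apart because for `a = 1` the first under-passage of the code, whose row and column are
deleted, is at `2`; for `a ≥ 3` it is at `6`. -/
theorem alexanderMinor_pretzel_one :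
    alexanderMinor (pretzel 3 1) = -X * pretzelPolynomial 1 (X : ℤ[X]) := by
  let V : ℕ → Fin 3 → ℤ[X]
    | 0 => ![1, 0, 0]
    | 1 => ![0, 1, 0]
    | 2 => 0
    | 3 => ![0, 0, 1]
    | 4 => ![0, 0, 1 - X]
    | _ => ![0, 1 - X, X]
  have h := alexanderMinor_pretzel_of_elimination (a := 1) (n := 2) (z := 2) odd_one (by decide)
    (Sum.elim ![0, 1, 3] ![4, 5]) (by decide) ?_ V rfl ?_ ?_ (by decide)
  · rw [h, Matrix.det_fin_three]
    simp [underArc, overArc, V, pretzelPolynomial, alternatingSum]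
    ring
  · intro l
    constructor
    · rintro ⟨s, rfl⟩
      revert s
      decide
    · rintro ⟨h₁, h₂⟩
      interval_cases l
      · exact ⟨Sum.inl 0, rfl⟩
      · exact ⟨Sum.inl 1, rfl⟩
      · exact absurd rfl h₂
      · exact ⟨Sum.inl 2, rfl⟩
      · exact ⟨Sum.inr 0, rfl⟩
      · exact ⟨Sum.inr 1, rfl⟩
  · intro k k'
    fin_cases k <;> fin_cases k' <;> simp [V]
  · intro j k
    fin_cases j <;> fin_cases k <;> simp [V, underArc, overArc]

theorem alexanderMinor_pretzel_of_three_le (ha : Odd a) (h3 : 3 ≤ a) :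
    alexanderMinor (pretzel 3 a) = -X * pretzelPolynomial a (X : ℤ[X]) := by
  obtain ⟨n, rfl⟩ := Nat.exists_eq_add_of_le' h3
  -- The arcs `0`, `1`, `2` are free and the arc `6` is zero. The conditions at all crossings but
  -- `0`, `1`, `2` and `6` then determine the other arcs; from `5` on they are multiples of the
  -- value at `5`.
  let V : ℕ → Fin 3 → ℤ[X]
    | 0 => ![1, 0, 0]
    | 1 => ![0, 1, 0]
    | 2 => ![0, 0, 1]
    | 3 => ![X, 0, 1 - X]
    | 4 => ![(1 - X) * X, 0, X + (1 - X) * (1 - X)]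
    | i + 5 => (1 - alternatingSum (X : ℤ[X]) i) • (![X * X, 1 - X, X * (1 - X)] : Fin 3 → ℤ[X])
  have h := alexanderMinor_pretzel_of_elimination (n := n + 4) (z := 6) ha ?_
    (Sum.elim (fun k : Fin 3 => (k : ℕ))
      fun j : Fin (n + 4) => if (j : ℕ) < 3 then (j : ℕ) + 3 else j + 4) ?_ ?_ V ?_ ?_ ?_ ?_
  · have e : (-1 : ℤ[X]) ^ (n + 4) = 1 := by
      apply Even.neg_one_pow
      obtain ⟨k, hk⟩ := ha
      exact ⟨k + 1, by omega⟩
    have e₁ : overArc (n + 3 + 4) = n + 1 + 5 := by simp [overArc]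
    have e₂ : n + 3 + 4 = n + 2 + 5 := rfl
    rw [h, e, Matrix.det_fin_three]
    simp only [Matrix.of_apply, Sum.elim_inl, Fin.coe_ofNat_eq_mod, underArc, Nat.zero_mod,
      Nat.one_mod, Nat.reduceMod, if_true, if_neg one_ne_zero, if_neg two_ne_zero,
      if_neg (show ¬ 2 = 1 by omega), e₁, e₂]
    simp [overArc, V, pretzelPolynomial, alternatingSum]
    ring
  · rw [pretzel_three_eq, show n + 3 = 2 + (n + 1) by ring, strand_add, strand_two]
    rfl
  · have hr : Function.Injective
        fun j : Fin (n + 4) => if (j : ℕ) < 3 then (j : ℕ) + 3 else j + 4 := by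
      intro i j hij
      dsimp only at hij
      ext
      split_ifs at hij <;> omega
    refine Function.Injective.sumElim Fin.val_injective hr fun k j => ?_
    have := k.2
    split_ifs <;> omega
  · intro l
    constructor
    · rintro ⟨k | j, rfl⟩
      · have := k.2
        simp only [Sum.elim_inl]
        omega
      · have := j.2
        simp only [Sum.elim_inr]
        split_ifs <;> omega
    · rintro ⟨h₁, h₂⟩
      rcases Nat.lt_or_ge l 3 with h | h
      · exact ⟨Sum.inl ⟨l, h⟩, rfl⟩
      · rcases Nat.lt_or_ge l 6 with h' | h'
        · refine ⟨Sum.inr ⟨l - 3, by omega⟩, ?_⟩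
          simp only [Sum.elim_inr]
          rw [if_pos (by omega)]
          omega
        · refine ⟨Sum.inr ⟨l - 4, by omega⟩, ?_⟩
          simp only [Sum.elim_inr]
          rw [if_neg (by omega)]
          omega
  · simp [V, alternatingSum]
  · intro k k'
    fin_cases k <;> fin_cases k' <;> simp [V]
  · intro j k
    have key : ∀ l, 3 ≤ l → l ≠ 6 →
        V l k = X * V (underArc (n + 3) l) k + (1 - X) * V (overArc l) k := by
      intro l h₁ h₂
      rcases (by omega : l = 3 ∨ l = 4 ∨ l = 5 ∨ 7 ≤ l) with rfl | rfl | rfl | h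
      · fin_cases k <;> simp [V, underArc, overArc]
      · fin_cases k <;> simp [V, underArc, overArc]
      · fin_cases k <;> simp [V, underArc, overArc, alternatingSum]
      · obtain ⟨i, rfl⟩ := Nat.exists_eq_add_of_le' h
        have e₁ : underArc (n + 3) (i + 7) = i + 5 := by simp [underArc]
        have e₂ : overArc (i + 7) = i + 1 + 5 := by simp [overArc]
        rw [e₁, e₂]
        change (1 - alternatingSum (X : ℤ[X]) (i + 2)) * _ =
          X * ((1 - alternatingSum (X : ℤ[X]) i) * _) +
            (1 - X) * ((1 - alternatingSum (X : ℤ[X]) (i + 1)) * _)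
        rw [alternatingSum_add_two]
        ring
    simp only [Sum.elim_inr]
    apply key <;> split_ifs <;> omega
  · intro i j hij
    have hij : (i : ℕ) ≤ j := hij
    have hlt : ∀ l, 3 ≤ l → underArc (n + 3) l < l ∧ overArc l < l := by
      intro l hl
      unfold underArc overArc
      constructor <;> split_ifs <;> omega
    simp only [Sum.elim_inr]
    obtain ⟨h₁, h₂⟩ := hlt (if (i : ℕ) < 3 then (i : ℕ) + 3 else i + 4) (by split_ifs <;> omega)
    have h₃ : (if (i : ℕ) < 3 then (i : ℕ) + 3 else i + 4) ≤
        if (j : ℕ) < 3 then (j : ℕ) + 3 else j + 4 := by split_ifs <;> omega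
    omega

theorem alexanderMinor_pretzel (ha : Odd a) :
    alexanderMinor (pretzel 3 a) = -X * pretzelPolynomial a (X : ℤ[X]) := by
  rcases (by obtain ⟨k, rfl⟩ := ha; omega : a = 1 ∨ 3 ≤ a) with rfl | h
  · exact alexanderMinor_pretzel_one
  · exact alexanderMinor_pretzel_of_three_le ha h

theorem pretzelPolynomial_X_coeff_zero (ha : 0 < a) :
    (pretzelPolynomial a (X : ℤ[X])).coeff 0 = 1 := by
  obtain ⟨n, rfl⟩ := Nat.exists_eq_add_of_le' ha
  simp [coeff_zero_eq_eval_zero, pretzelPolynomial, alternatingSum_succ]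

/-- The minor is `-X` times a polynomial with constant coefficient `1`, so the normalization removes
exactly this unit. -/
theorem reducedAlexander_pretzel (ha : Odd a) :
    reducedAlexander (pretzel 3 a) = pretzelPolynomial a (X : ℤ[X]) := by
  set P := pretzelPolynomial a (X : ℤ[X]) with hP
  have h0 : P.coeff 0 = 1 := pretzelPolynomial_X_coeff_zero ha.pos
  have hne : P ≠ 0 := by
    rintro h
    simp [h] at h0
  have hmin : alexanderMinor (pretzel 3 a) = -P * X := by
    rw [alexanderMinor_pretzel ha]
    ring
  have hdeg : P.natTrailingDegree = 0 := natTrailingDegree_eq_zero.2 (Or.inr (by simp [h0]))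
  have h₁ : (-P * X).natTrailingDegree = 1 := by
    rw [natTrailingDegree_mul (neg_ne_zero.2 hne) X_ne_zero, natTrailingDegree_neg, hdeg,
      natTrailingDegree_X]
  have h₂ : (-P * X).trailingCoeff = -1 := by
    rw [trailingCoeff, h₁, coeff_mul_X, coeff_neg, h0]
  rw [reducedAlexander, hmin, h₁, h₂, Function.iterate_one]
  ext n
  simp [coeff_divX]

end GaussCode

/-! ### The minimum number of colors -/

theorem mainTheorem5 (a : ℕ) (ha : Odd a) (m : ℤ) (hm : 1 < m) (p : ℕ) (hp : p.Prime) (hodd : Odd p)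
    (hpm : (p : ℤ) = (GaussCode.reducedAlexander (GaussCode.pretzel 3 a)).eval m) :
    a + 4 ≤ GaussCode.mincol p m (GaussCode.pretzel 3 a) ∧
      (m = 2 →
        GaussCode.mincol p m (GaussCode.pretzel 3 a) = a + 4 ∧
        (GaussCode.arcs (GaussCode.pretzel 3 a)).card = a + 5 ∧
        ∃ c, GaussCode.IsNontrivialColoring p m (GaussCode.pretzel 3 a) c ∧
          GaussCode.numColors (GaussCode.pretzel 3 a) c = a + 4) := by
  have : Fact p.Prime := ⟨hp⟩
  have hpΔ : (p : ℤ) = GaussCode.pretzelPolynomial a m := by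
    rw [hpm, GaussCode.reducedAlexander_pretzel ha, ← coe_evalRingHom,
      GaussCode.map_pretzelPolynomial]
    simp
  have hlt : m ^ (a + 2) < p := hpΔ ▸ GaussCode.pow_lt_pretzelPolynomial ha hm
  have hmod : GaussCode.pretzelPolynomial a (m : ZMod p) = 0 := by
    have h := GaussCode.map_pretzelPolynomial (Int.castRingHom (ZMod p)) a m
    rw [← hpΔ] at h
    simpa using h.symm
  -- Here `0 < m - 1 < p`, because `m ≤ m ^ (a + 2) < p`.
  have hm1 : (m : ZMod p) ≠ 1 := by
    intro h
    have h₁ : (p : ℤ) ∣ m - 1 := by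
      rw [← ZMod.intCast_zmod_eq_zero_iff_dvd]
      simp [h]
    have h₂ := Int.le_of_dvd (by omega) h₁
    have h₃ : m ≤ m ^ (a + 2) := le_self_pow₀ (by omega) (by omega)
    omega
  have htriv : GaussCode.OnlyTrivialWalks (m : ℚ) (GaussCode.pretzel 3 a) := by
    refine GaussCode.onlyTrivialWalks_pretzel ha (by exact_mod_cast hm.ne') ?_
    have h := GaussCode.map_pretzelPolynomial (Int.castRingHom ℚ) a m
    rw [← hpΔ] at h
    simp only [eq_intCast, Int.cast_natCast] at h
    rw [← h]
    exact_mod_cast hp.ne_zero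
  have hcol := GaussCode.pretzelColor_isNontrivialColoring ha hmod hm1
  have hdiag := GaussCode.pretzel_isDiagram ha
  have hlower : ∀ v, GaussCode.IsDiagram v → GaussCode.SameKnot v (GaussCode.pretzel 3 a) →
      ∀ c, GaussCode.IsNontrivialColoring p m v c → a + 4 ≤ GaussCode.numColors v c := by
    intro v hv hsame c hc
    have h := GaussCode.prime_le_pow_numColors hm hv.1
      ((hsame.onlyTrivialWalks_iff (by exact_mod_cast (by omega : m ≠ 0))).2 htriv) hc
    -- From `m ^ (a + 2) < p ≤ m ^ (n - 1)` the strict inequality `a + 2 < n - 1` follows, which is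
    -- `a + 4 ≤ n`.
    have h₁ := (pow_lt_pow_iff_right₀ hm).1 (hlt.trans_le h)
    omega
  have hself : GaussCode.SameKnot (GaussCode.pretzel 3 a) (GaussCode.pretzel 3 a) :=
    Relation.EqvGen.refl _
  have hmin : a + 4 ≤ GaussCode.mincol p m (GaussCode.pretzel 3 a) := by
    -- The standard diagram shows that the set is nonempty; the infimum of the empty set would be
    -- `0`.
    refine le_csInf ⟨_, _, hdiag, hself, _, hcol, rfl⟩ ?_
    rintro n ⟨v, hv, hsame, c, hc, rfl⟩
    exact hlower v hv hsame c hc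
  refine ⟨hmin, fun hm2 => ?_⟩
  -- The remaining colors need not be compared: the lower bound applied to the standard diagram
  -- excludes further coincidences.
  have hnum : GaussCode.numColors (GaussCode.pretzel 3 a)
      (fun x => GaussCode.pretzelColor a (m : ZMod p) x.label) = a + 4 :=
    le_antisymm (GaussCode.numColors_pretzelColor_le ha hm2) (hlower _ hdiag hself _ hcol)
  exact ⟨le_antisymm (Nat.sInf_le ⟨_, hdiag, hself, _, hcol, hnum⟩) hmin,
    GaussCode.card_arcs_pretzel, _, hcol, hnum⟩
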